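/- Let $\mathbb{K}$ be a field. All relations are reflexive binary relations on $[n]=\{1,\dots,n\}$ for some $n\ge 0$. For $X\subseteq[n]$, let $R_X$ be the restriction of $R$ to $X$, standardized to a relation on $[\#X]$. For relations $R$ on $[m]$ and $S$ on $[n]$, the shifted shuffle of $R$ and $S$ is the set of all relations $T$ on $[m+n]$ with $T_{[m]}=R$ and $T_{\{m+1,\dots,m+n\}}=S$. A total cut of a relation $T$ on $[p]$ is a partition $[p]=X\sqcup Y$ such that $x\,T\,y$ and not $y\,T\,x$ for all $x\in X$, $y\in Y$. We consider the following families of relations. * Weak order. For a permutation $\sigma$ of $[n]$, let $u\prec_\sigma v$ if $\sigma^{-1}(u)\le\sigma^{-1}(v)$; these posets form $\mathrm{WOEP}$. For $\sigma\le\sigma'$ in the weak order on permutations (inclusion of inversion sets), let $\prec_{[\sigma,\sigma']}=\bigcap_{\sigma\le\tau\le\sigma'}\prec_\tau$; these posets form $\mathrm{WOIP}$. For an ordered partition $\pi$ of $[n]$, let $u\prec_\pi v$ if $u=v$ or the block of $u$ comes strictly before the block of $v$; these posets form $\mathrm{WOFP}$. * Tamari order. For a binary tree $t$ with $n$ nodes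 labeled in inorder, let $i\prec_t j$ if $i$ is a (weak) descendant of $j$; these posets form $\mathrm{TOEP}$. For $t\le t'$ in the Tamari lattice (whose cover relations are the right rotations), let $\prec_{[t,t']}=\bigcap_{t\le s\le t'}\prec_s$; these posets form $\mathrm{TOIP}$. For a Schröder tree $S$ (a plane rooted tree whose internal nodes have at least two children) with $n$ angles between consecutive children, labeled in inorder, let $i\prec_S j$ if $i=j$ or the angle $i$ belongs to the left or right child of the angle $j$; these posets form $\mathrm{TOFP}$. For $P\in\{\mathrm{WOIP},\mathrm{WOEP},\mathrm{WOFP}\}$, let $\mathbb{K}P$ be the vector space with basis $(F_R)_{R\in P}$, with the product and coproduct $$F_R\cdot F_S=\sum_{T} F_T,\qquad \Delta(F_T)=\sum_{(X,Y)} F_{T_X}\otimes F_{T_Y},$$ where $T$ runs over the elements of $P$ in the shifted shuffle of $R$ and $S$, and $(X,Y)$ runs over the total cuts of $T$ (the restrictions $T_X$ and $T_Y$ are then again in $P$). The unit is $F_\varnothing$, where $\varnothing$ is the relation of size $0$, and the counit takes the coefficient of $F_\varnothing$. The TOIP deletion of a relation $R$ is $$R\smallsetminus\bigl(\{(a,c):\exists\,a<b<c,\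 (b,c)\notin R\}\cup\{(c,a):\exists\,a<b<c,\ (b,a)\notin R\}\bigr).$$ **Proposition.** Let $(P,Q)$ be one of the pairs $(\mathrm{WOIP},\mathrm{TOIP})$, $(\mathrm{WOEP},\mathrm{TOEP})$, $(\mathrm{WOFP},\mathrm{TOFP})$. For $T\in Q$, let $F^Q_T\in\mathbb{K}P$ be the sum of the $F_R$ over all $R\in P$ whose TOIP deletion is $T$, and let $\mathbb{K}Q$ be the linear subspace of $\mathbb{K}P$ spanned by the elements $F^Q_T$, $T\in Q$. Then $(F^Q_T)_{T\in Q}$ is a basis of $\mathbb{K}Q$. The subspace $\mathbb{K}Q$ is stable under the product and the coproduct: $x\cdot y\in\mathbb{K}Q$ and $\Delta(x)\in\mathbb{K}Q\otimes\mathbb{K}Q$ for all $x,y\in\mathbb{K}Q$. With these operations $\mathbb{K}P$ is a Hopf algebra, and $\mathbb{K}Q$ is a Hopf subalgebra of it (it contains the unit and is also stable under the antipode). -/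

import Mathlib

open scoped TensorProduct

namespace IntegerPosets

/-! ### Integer relations

A size `n` relation lives on `Fin n`, so that the integer `i ∈ [n]` is `i - 1 : Fin n`. -/

/-- Reflexive binary relations on `[n]`. -/
abbrev IRel (n : ℕ) : Type := {r : Fin n → Fin n → Prop // ∀ i, r i i}

noncomputable instance (n : ℕ) : Fintype (IRel n) := Fintype.ofFinite _

/-- The restriction of a relation to `X ⊆ [n]`, standardized to a relation on `[#X]`. -/
def restrict {n : ℕ} (R : IRel n) (X : Finset (Fin n)) : IRel X.card :=
  ⟨fun i j => R.1 (X.orderEmbOfFin rfl i) (X.orderEmbOfFin rfl j), fun _ => R.2 _⟩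

/-- `T` is in the shifted shuffle of `R` and `S`: `T` consists of `R` on `[m]`, of the shift of `S`
on `{m+1, …, m+n}`, and of arbitrary relations between these two sets. -/
def InShiftedShuffle {m n : ℕ} (R : IRel m) (S : IRel n) (T : IRel (m + n)) : Prop :=
  (∀ i j : Fin m, T.1 (Fin.castAdd n i) (Fin.castAdd n j) ↔ R.1 i j) ∧
  (∀ i j : Fin n, T.1 (Fin.natAdd m i) (Fin.natAdd m j) ↔ S.1 i j)

/-- `(X, [p] ∖ X)` is a total cut of `T`. -/
def IsTotalCut {p : ℕ} (T : IRel p) (X : Finset (Fin p)) : Prop :=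
  ∀ x ∈ X, ∀ y ∉ X, T.1 x y ∧ ¬ T.1 y x

/-! ### The algebra on a family of relations -/

/-- A family of relations: for each size `n`, a set of relations of size `n`. -/
abbrev Family : Type := ∀ n : ℕ, Set (IRel n)

/-- The vector space `K P = ⨁ₙ K Pₙ` with basis a family `P` of relations. -/
abbrev KSpan (K : Type*) [Field K] (P : Family) : Type _ := (Σ n : ℕ, P n) →₀ K

section Algebra

variable (K : Type*) [Field K] (P : Family)

open scoped Classical in
/-- The image of the basis vector `F_R` in `K P`: the basis vector if `R ∈ P`, and `0` otherwise
(relations that are not in `P` are deleted). -/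
noncomputable def F {n : ℕ} (R : IRel n) : KSpan K P :=
  if h : R ∈ P n then Finsupp.single ⟨n, ⟨R, h⟩⟩ 1 else 0

open scoped Classical in
/-- The product of `K P`: `F_R · F_S` is the sum of the `F_T` over the relations `T` of `P` in the
shifted shuffle of `R` and `S`. -/
noncomputable def product : KSpan K P →ₗ[K] KSpan K P →ₗ[K] KSpan K P :=
  Finsupp.linearCombination K fun R : Σ n, P n =>
    Finsupp.linearCombination K fun S : Σ n, P n =>
      ∑ T : IRel (R.1 + S.1) with InShiftedShuffle R.2.1 S.2.1 T, F K P T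

open scoped Classical in
/-- The coproduct of `K P`: `Δ(F_T)` is the sum of the `F_{T_X} ⊗ F_{T_Y}` over the total cuts
`(X, Y)` of `T`. -/
noncomputable def coproduct : KSpan K P →ₗ[K] KSpan K P ⊗[K] KSpan K P :=
  Finsupp.linearCombination K fun T : Σ n, P n =>
    ∑ X : Finset (Fin T.1) with IsTotalCut T.2.1 X,
      F K P (restrict T.2.1 X) ⊗ₜ[K] F K P (restrict T.2.1 Xᶜ)

/-- The unit `F_∅`, where `∅` is the relation of size `0`. -/
noncomputable def unit : KSpan K P := F K P (⟨fun _ _ => True, fun _ => trivial⟩ : IRel 0)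

/-- The counit: it takes the coefficient of the relation of size `0`. -/
noncomputable def counit : KSpan K P →ₗ[K] K :=
  Finsupp.linearCombination K fun T : Σ n, P n => if T.1 = 0 then 1 else 0

end Algebra

universe u

/-- The operations `(mul, one, comul, counit)` make the vector space `A` a Hopf algebra, and the
subspace `W` is a Hopf subalgebra of it: a subalgebra and a subcoalgebra that the antipode
preserves. The Hopf algebra structure of `A` is expressed by an isomorphism `e` with a Hopf algebra
`H` that carries the given operations of `A` to those of `H`. -/
structure IsHopfSubalgebra {K A : Type u} [Field K] [AddCommGroup A] [Module K A]
    (mul : A →ₗ[K] A →ₗ[K] A) (one : A) (comul : A →ₗ[K] A ⊗[K] A) (counit : A →ₗ[K] K)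
    (W : Submodule K A) : Prop where
  one_mem : one ∈ W
  mul_mem : ∀ x ∈ W, ∀ y ∈ W, mul x y ∈ W
  comul_mem : ∀ x ∈ W, comul x ∈ LinearMap.range (TensorProduct.map W.subtype W.subtype)
  hopf : ∃ (H : Type u) (_ : Ring H) (_ : HopfAlgebra K H) (e : A ≃ₗ[K] H),
    (∀ x y, e (mul x y) = e x * e y) ∧
    e one = 1 ∧
    (∀ x, Coalgebra.comul (R := K) (e x) =
      TensorProduct.map e.toLinearMap e.toLinearMap (comul x)) ∧
    (∀ x, Coalgebra.counit (R := K) (e x) = counit x) ∧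
    ∀ x ∈ W, e.symm (HopfAlgebra.antipode K (e x)) ∈ W

/-! ### Elements, intervals and faces of the weak order -/

/-- The weak order element poset of `σ`: `u` is below `v` when `u` appears weakly before `v` in the
word `σ(1) … σ(n)`. -/
def permRel {n : ℕ} (σ : Equiv.Perm (Fin n)) (u v : Fin n) : Prop := σ.symm u ≤ σ.symm v

/-- The inversions of `σ`: the pairs of values `a < b` such that `b` appears before `a`. -/
def inversions {n : ℕ} (σ : Equiv.Perm (Fin n)) : Set (Fin n × Fin n) :=
  {p | p.1 < p.2 ∧ σ.symm p.2 < σ.symm p.1}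

/-- The weak order on permutations. -/
def WeakLE {n : ℕ} (σ τ : Equiv.Perm (Fin n)) : Prop := inversions σ ⊆ inversions τ

/-- Weak order element posets. -/
def WOEP : Family := fun n => {R | ∃ σ : Equiv.Perm (Fin n), ∀ u v, R.1 u v ↔ permRel σ u v}

/-- Weak order interval posets: the intersections of the posets of all permutations in a weak order
interval `[σ, σ']`. -/
def WOIP : Family := fun n => {R | ∃ σ σ' : Equiv.Perm (Fin n), WeakLE σ σ' ∧
  ∀ u v, R.1 u v ↔ ∀ τ, WeakLE σ τ → WeakLE τ σ' → permRel τ u v}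

/-- Weak order face posets: an ordered partition of `[n]` into `k` blocks is given by the surjection
`π : [n] → [k]` that sends an element to the index of its block. -/
def WOFP : Family := fun n => {R | ∃ (k : ℕ) (π : Fin n → Fin k), Function.Surjective π ∧
  ∀ u v, R.1 u v ↔ u = v ∨ π u < π v}

/-! ### Elements, intervals and faces of the Tamari lattice -/

/-- `Descendant t i j`: in the binary tree `t`, with its nodes labeled `0, 1, 2, …` in inorder, the
node `i` is a (weak) descendant of the node `j`. -/
def Descendant : BinaryTree Unit → ℕ → ℕ → Prop
  | .nil, _, _ => False
  | .node _ l r, i, j =>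
      (j = l.numNodes ∧ i < l.numNodes + r.numNodes + 1) ∨
      Descendant l i j ∨
      (l.numNodes < i ∧ l.numNodes < j ∧
        Descendant r (i - (l.numNodes + 1)) (j - (l.numNodes + 1)))

/-- Right rotations of binary trees. -/
inductive RightRotation : BinaryTree Unit → BinaryTree Unit → Prop
  | root (a b c : BinaryTree Unit) :
      RightRotation (.node () (.node () a b) c) (.node () a (.node () b c))
  | left {l l' : BinaryTree Unit} (r : BinaryTree Unit) :
      RightRotation l l' → RightRotation (.node () l r) (.node () l' r)
  | right (l : BinaryTree Unit) {r r' : BinaryTree Unit} :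
      RightRotation r r' → RightRotation (.node () l r) (.node () l r')

/-- The Tamari order on binary trees. -/
def TamariLE : BinaryTree Unit → BinaryTree Unit → Prop := Relation.ReflTransGen RightRotation

/-- Tamari order element posets. -/
def TOEP : Family := fun n => {R | ∃ t : BinaryTree Unit, t.numNodes = n ∧
  ∀ u v, R.1 u v ↔ Descendant t u v}

/-- Tamari order interval posets: the intersections of the posets of all binary trees in a Tamari
interval `[t, t']`. -/
def TOIP : Family := fun n => {R | ∃ t t' : BinaryTree Unit,
  t.numNodes = n ∧ t'.numNodes = n ∧ TamariLE t t' ∧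
  ∀ u v, R.1 u v ↔ ∀ s, TamariLE t s → TamariLE s t' → Descendant s u v}

/-- Schröder trees: plane rooted trees in which each internal node has at least two children. -/
inductive SchroderTree : Type
  | leaf : SchroderTree
  | node (k : ℕ) (child : Fin (k + 2) → SchroderTree) : SchroderTree

namespace SchroderTree

/-- The number of angles: a node with `k + 2` children has `k + 1` angles, each between two
consecutive children. -/
def numAngles : SchroderTree → ℕ
  | leaf => 0
  | node k child => (∑ t, (child t).numAngles) + (k + 1)

/-- In a tree whose root has the given children, with angles labeled `0, 1, 2, …` in inorder, the
number of angles that come before those of the subtree `child t`: those of the previous children,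
and one angle of the root after each previous child. -/
def offset {k : ℕ} (child : Fin (k + 2) → SchroderTree) (t : Fin (k + 2)) : ℕ :=
  ∑ s with s < t, ((child s).numAngles + 1)

/-- The label of the angle of the root between `child t` and `child (t + 1)`. -/
def rootAngle {k : ℕ} (child : Fin (k + 2) → SchroderTree) (t : Fin (k + 1)) : ℕ :=
  offset child t.castSucc + (child t.castSucc).numAngles

/-- The angle `i` belongs to the subtree `child t` of the root. -/
def InChild {k : ℕ} (child : Fin (k + 2) → SchroderTree) (t : Fin (k + 2)) (i : ℕ) : Prop :=
  offset child t ≤ i ∧ i < offset child t + (child t).numAngles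

/-- `Below S i j`: in the Schröder tree `S`, with angles labeled `0, 1, 2, …` in inorder, the angle
`i` is the angle `j`, or it belongs to the left or to the right child of the angle `j`. The angle
`j` is either an angle of the root or an angle of the subtree at some child of the root. -/
def Below : SchroderTree → ℕ → ℕ → Prop
  | leaf, _, _ => False
  | node k child, i, j =>
      (∃ t : Fin (k + 1), j = rootAngle child t ∧
        (i = j ∨ InChild child t.castSucc i ∨ InChild child t.succ i)) ∨
      (∃ t : Fin (k + 2), InChild child t i ∧ InChild child t j ∧
        Below (child t) (i - offset child t) (j - offset child t))

end SchroderTree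

/-- Tamari order face posets. -/
def TOFP : Family := fun n => {R | ∃ S : SchroderTree, S.numAngles = n ∧
  ∀ u v, R.1 u v ↔ S.Below u v}

/-! ### The deletion map and the sums over its fibers -/

/-- The TOIP deletion: it deletes the increasing pairs `(a, c)` such that some `a < b < c` has
`(b, c) ∉ R`, and the decreasing pairs `(c, a)` such that some `a < b < c` has `(b, a) ∉ R`. -/
def toipDeletion {n : ℕ} (R : IRel n) : IRel n :=
  ⟨fun u v => R.1 u v ∧ ¬ (∃ b, u < b ∧ b < v ∧ ¬ R.1 b v) ∧ ¬ (∃ b, v < b ∧ b < u ∧ ¬ R.1 b v),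
    fun i => ⟨R.2 i, fun ⟨_, h, h', _⟩ => lt_asymm h h', fun ⟨_, h, h', _⟩ => lt_asymm h h'⟩⟩

open scoped Classical in
/-- In `K P`, the sum of the `F_R` over all `R ∈ P` whose TOIP deletion is `T`. -/
noncomputable def fiberSum (K : Type*) [Field K] (P : Family) {n : ℕ} (T : IRel n) : KSpan K P :=
  ∑ R : IRel n with R ∈ P n ∧ toipDeletion R = T, F K P R

/-- The subspace of `K P` spanned by the sums over the fibers of the relations in `Q`. -/
noncomputable def fiberSpan (K : Type*) [Field K] (P Q : Family) : Submodule K (KSpan K P) :=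
  Submodule.span K (Set.range fun T : Σ n, Q n => fiberSum K P T.2.1)

/-- In `K P`, the sums over the fibers of the relations in `Q` form a basis of their span, and this
span is a Hopf subalgebra of the Hopf algebra `K P`. -/
structure DefinesHopfSubalgebra (K : Type u) [Field K] (P Q : Family) : Prop where
  linearIndependent : LinearIndependent K fun T : Σ n, Q n => fiberSum K P T.2.1
  isHopfSubalgebra :
    IsHopfSubalgebra (product K P) (unit K P) (coproduct K P) (counit K P) (fiberSpan K P Q)

end IntegerPosets

/-! Hopf structure on `K P`. Relations outside `P` count as zero, so `K P` should be seen as a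
quotient of the space on all reflexive relations. Closure of `P` under increasing pullback makes the
omitted relations an ideal (`product_F`), and closure under gluing along a total cut makes them a
coideal (`coproduct_F`). The axioms then become bijections between sums over relations with
prescribed restrictions. In particular, the coproduct is multiplicative because pulling back a glued
relation amounts to gluing the pullbacks (`comap_glue`). The antipode is the geometric series of `1
- id` in the convolution algebra, finite on each size.

Hopf subalgebra. Suppose that the deletion maps `P` onto `Q`. Its fibers over `Q` are disjoint and
nonempty, whence the independence. The deletion commutes with restriction to an interval
(`del_comap`), so a product of fiber sums is a sum over whole fibers. The deletion of a glued
relation depends only on the deletions of its two parts (`del_glue_congr`), so the coproduct of a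
fiber sum is a sum of tensors of fiber sums. The antipode preserves the span because every
convolution power of `1 - id` does.

Combinatorics. It remains to see that `Q` is the image of `P`. A relation of `P` is described by
integer labels, and its deletion keeps `u` below `v` exactly when `v` has a greater label than
everything else between them. This is descent in the tree whose root is at the maximal label: a
binary tree for distinct labels, a Schröder tree when the maximum may repeat. Conversely, every tree
carries such a labeling. For an interval, the lower endpoint governs the decreasing pairs and the
upper one the increasing pairs. The two trees are comparable because inclusion of increasing
descendants already gives the Tamari order (`tamariLE_of_descendant`). -/

namespace IntegerPosets

universe u

/-! ### Reflexive relations on finite linear orders -/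

section ReflRel

variable {α β γ : Type*}

/-- Reflexive binary relations on `α`. -/
abbrev ReflRel (α : Type*) : Type _ := {r : α → α → Prop // ∀ i, r i i}

noncomputable instance : DecidableEq (ReflRel α) := Classical.decEq _

noncomputable instance [Finite α] : Fintype (ReflRel α) := Fintype.ofFinite _

noncomputable instance [Finite α] : Fintype (Set α) := Fintype.ofFinite _

namespace ReflRel

/-- The pullback of a relation along a map. -/
def comap (f : β → α) (T : ReflRel α) : ReflRel β := ⟨fun i j => T.1 (f i) (f j), fun _ => T.2 _⟩

/-- The restriction of a relation to a set. -/
def restr (T : ReflRel α) (X : Set α) : ReflRel X := T.comap Subtype.val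

/-- `(X, Y)` is a total cut of the restriction of `T` to `X ∪ Y`. -/
def IsCut (T : ReflRel α) (X Y : Set α) : Prop := ∀ x ∈ X, ∀ y ∈ Y, T.1 x y ∧ ¬ T.1 y x

@[ext] lemma ext {R S : ReflRel α} (h : ∀ i j, R.1 i j ↔ S.1 i j) : R = S :=
  Subtype.ext (funext fun i => funext fun j => propext (h i j))

lemma ext_iff' {R S : ReflRel α} : R = S ↔ ∀ i j, R.1 i j ↔ S.1 i j :=
  ⟨fun h _ _ => h ▸ Iff.rfl, ext⟩

@[simp] lemma comap_id (T : ReflRel α) : T.comap id = T := rfl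

/-- Relations on order isomorphic (or equivalent) types correspond to each other. -/
def comapEquiv (e : α ≃ β) : ReflRel β ≃ ReflRel α where
  toFun T := T.comap e
  invFun T := T.comap e.symm
  left_inv T := by ext; simp [comap]
  right_inv T := by ext; simp [comap]

end ReflRel

/-- The relations `V` are grouped by their pullback. This collapses the nested sums of an iterated
product. -/
lemma sum_comap_eq {M : Type*} [AddCommMonoid M] [Finite α] [Finite γ] (f : α → γ) (p : ReflRel α → Prop)
    (q : ReflRel γ → Prop) [DecidableEq (ReflRel α)] [DecidablePred p] [DecidablePred q]
    (h : ReflRel γ → M) :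
    ∑ T : ReflRel α with p T, ∑ V : ReflRel γ with V.comap f = T ∧ q V, h V =
      ∑ V : ReflRel γ with p (V.comap f) ∧ q V, h V := by
  simp only [Finset.sum_filter]
  rw [show (∑ T : ReflRel α, if p T then ∑ V : ReflRel γ, if V.comap f = T ∧ q V then h V else 0
    else 0) = ∑ T : ReflRel α, ∑ V : ReflRel γ,
      if V.comap f = T then (if p (V.comap f) ∧ q V then h V else 0) else 0 from ?_]
  · rw [Finset.sum_comm]
    simp
  · refine Finset.sum_congr rfl fun T _ => ?_
    by_cases hp : p T
    · rw [if_pos hp]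
      refine Finset.sum_congr rfl fun V _ => ?_
      by_cases hV : V.comap f = T
      · subst hV; simp [hp]
      · simp [hV]
    · rw [if_neg hp, Finset.sum_eq_zero]
      intro V _
      by_cases hV : V.comap f = T
      · subst hV; simp [hp]
      · simp [hV]

end ReflRel

/-! ### Families of relations, their vector spaces and standardization -/

open ReflRel

/-- A family of relations that is closed under restrictions and under gluing along total cuts, and
contains the empty relation. -/
class IsHopfFamily (P : Family) : Prop where
  mem_comap : ∀ {m n : ℕ} {R : IRel n} (f : Fin m → Fin n), StrictMono f → R ∈ P n →
    comap f R ∈ P m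
  mem_of_cut : ∀ {k l n : ℕ} {T : IRel n} (f : Fin k → Fin n) (g : Fin l → Fin n),
    StrictMono f → StrictMono g → (∀ i, i ∈ Set.range f ∨ i ∈ Set.range g) →
    (∀ i j, T.1 (f i) (g j) ∧ ¬ T.1 (g j) (f i)) →
    comap f T ∈ P k → comap g T ∈ P l → T ∈ P n
  empty_mem : ∀ R : IRel 0, R ∈ P 0

/-- The vector space `K P`, to be equipped with its Hopf algebra structure. -/
def HopfSpan (K : Type u) [Field K] (P : Family) : Type u := KSpan K P

section HopfSpan

variable (K : Type u) [Field K] (P : Family)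

noncomputable instance : AddCommGroup (HopfSpan K P) := inferInstanceAs (AddCommGroup (KSpan K P))
noncomputable instance : Module K (HopfSpan K P) := inferInstanceAs (Module K (KSpan K P))

/-- The image in `K P` of a relation on a finite linear order, standardized. -/
noncomputable def std {α : Type*} [LinearOrder α] [Finite α] (T : ReflRel α) : HopfSpan K P :=
  letI := Fintype.ofFinite α
  F K P (T.comap (Fintype.orderIsoFinOfCardEq α rfl))

/-- The image in `K P` of the restriction of a relation to a set. -/
noncomputable def stdOn {α : Type*} [LinearOrder α] [Finite α] (T : ReflRel α) (X : Set α) :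
    HopfSpan K P :=
  std K P (T.restr X)

variable {α β γ : Type*} [LinearOrder α] [Finite α] [LinearOrder β] [Finite β]
  [LinearOrder γ] [Finite γ]

/-- A finite linear order is order isomorphic to a `Fin n` in only one way, so standardization
involves no choice. Sums can then be indexed by relations on any convenient linear order, without
casts between sizes. -/
lemma F_comap_orderIso {n : ℕ} (e : Fin n ≃o α) (T : ReflRel α) :
    F K P (T.comap e) = std K P T := by
  let := Fintype.ofFinite α
  obtain rfl : Fintype.card α = n := by simpa using (Fintype.card_congr e.toEquiv).symm
  rw [Subsingleton.elim e (Fintype.orderIsoFinOfCardEq α rfl)]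
  rfl

lemma std_fin {n : ℕ} (R : IRel n) : std K P R = F K P R :=
  (F_comap_orderIso K P (OrderIso.refl _) R).symm

lemma exists_orderIso_fin (α : Type*) [LinearOrder α] [Finite α] :
    ∃ n, Nonempty (Fin n ≃o α) :=
  let := Fintype.ofFinite α
  ⟨_, ⟨Fintype.orderIsoFinOfCardEq α rfl⟩⟩

lemma std_fin_comap {n : ℕ} (e : Fin n ≃o α) (T : ReflRel α) :
    std K P (T.comap e) = std K P T := by
  rw [← F_comap_orderIso K P e T, ← F_comap_orderIso K P (OrderIso.refl _) (T.comap e)]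
  rfl

lemma std_comap_orderIso (e : α ≃o β) (T : ReflRel β) :
    std K P (T.comap e) = std K P T := by
  obtain ⟨n, ⟨i⟩⟩ := exists_orderIso_fin α
  rw [← std_fin_comap K P i, ← std_fin_comap K P (i.trans e)]
  rfl

lemma std_comap {f : β → α} (hf : StrictMono f) (T : ReflRel α) :
    std K P (T.comap f) = stdOn K P T (Set.range f) :=
  std_comap_orderIso K P (StrictMono.orderIso f hf) (T.restr (Set.range f))

lemma stdOn_univ (T : ReflRel α) : stdOn K P T Set.univ = std K P T := by
  rw [← Set.range_id, ← std_comap K P strictMono_id, comap_id]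

lemma stdOn_comap {f : β → α} (hf : StrictMono f) (T : ReflRel α) (X : Set β) :
    stdOn K P (T.comap f) X = stdOn K P T (f '' X) := by
  have := std_comap K P (f := f ∘ (Subtype.val : X → β)) (fun _ _ h => hf h) T
  rw [Set.range_comp, Subtype.range_coe] at this
  exact this

lemma F_of_notMem {n : ℕ} {R : IRel n} (h : R ∉ P n) : F K P R = 0 := dif_neg h

variable {P} in
lemma F_single {n : ℕ} {R : IRel n} (h : R ∈ P n) :
    F K P R = Finsupp.single ⟨n, ⟨R, h⟩⟩ 1 := dif_pos h

variable {K P} in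
lemma hopfSpan_lhom_ext {M : Type*} [AddCommMonoid M] [Module K M] {f g : HopfSpan K P →ₗ[K] M}
    (h : ∀ n (R : IRel n), f (std K P R) = g (std K P R)) : f = g := by
  refine Finsupp.lhom_ext' fun ⟨n, R, hR⟩ => LinearMap.ext_ring ?_
  have := h n R
  rw [std_fin, F_single K hR] at this
  exact this

noncomputable instance : NonUnitalNonAssocRing (HopfSpan K P) where
  mul x y := product K P x y
  left_distrib x := map_add (product K P x)
  right_distrib x y := LinearMap.map_add₂ (product K P) x y
  zero_mul := LinearMap.map_zero₂ (product K P)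
  mul_zero x := map_zero (product K P x)

/-! ### The product and its associativity -/

section Product

variable [IsHopfFamily P]

open scoped Classical in
-- If `R` or `S` is outside `P`, then so is every `T` in the shifted shuffle, since both are
-- pullbacks of `T`. The formula thus needs no membership hypothesis.
lemma product_F {m n : ℕ} (R : IRel m) (S : IRel n) :
    product K P (F K P R) (F K P S) =
      ∑ T : IRel (m + n) with InShiftedShuffle R S T, F K P T := by
  by_cases hR : R ∈ P m
  · by_cases hS : S ∈ P n
    · simp [F_single K hR, F_single K hS, product]
    · rw [F_of_notMem K P hS, map_zero, Finset.sum_eq_zero]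
      intro T hT
      rw [Finset.mem_filter] at hT
      refine F_of_notMem K P fun h => hS ?_
      have := IsHopfFamily.mem_comap _ (Fin.strictMono_natAdd m) h
      rwa [show comap _ T = S from ReflRel.ext hT.2.2] at this
  · rw [F_of_notMem K P hR, map_zero, LinearMap.zero_apply, Finset.sum_eq_zero]
    intro T hT
    rw [Finset.mem_filter] at hT
    refine F_of_notMem K P fun h => hR ?_
    have := IsHopfFamily.mem_comap _ (Fin.strictMono_castAdd n) h
    rwa [show comap _ T = R from ReflRel.ext hT.2.1] at this

open scoped Classical in
lemma std_mul_std_fin {m n : ℕ} (R : IRel m) (S : IRel n) :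
    std K P R * std K P S = ∑ T : IRel (m + n) with InShiftedShuffle R S T, std K P T := by
  simp only [std_fin]
  exact product_F K P R S

open scoped Classical in
/-- The product of `K P`, on any linear order that is cut into an initial and a final part. -/
lemma std_mul_std {f : α → γ} {g : β → γ} (hf : StrictMono f) (hg : StrictMono g)
    (hfg : ∀ a b, f a < g b) (hsurj : ∀ c, c ∈ Set.range f ∨ c ∈ Set.range g)
    (R : ReflRel α) (S : ReflRel β) :
    std K P R * std K P S =
      ∑ T : ReflRel γ with T.comap f = R ∧ T.comap g = S, std K P T := by
  obtain ⟨m, ⟨i⟩⟩ := exists_orderIso_fin α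
  obtain ⟨n, ⟨j⟩⟩ := exists_orderIso_fin β
  -- The standardizations of the initial and the final part concatenate to that of `γ`.
  have hmono : StrictMono (Fin.addCases (motive := fun _ => γ) (fun a => f (i a))
      (fun b => g (j b)) : Fin (m + n) → γ) := by
    intro x y hxy
    induction x using Fin.addCases with
    | left x =>
      induction y using Fin.addCases with
      | left y => simpa using hf (i.strictMono hxy)
      | right y => simpa using hfg _ _
    | right x =>
      induction y using Fin.addCases with
      | left y => simp [Fin.lt_def] at hxy; omega
      | right y => simpa using hg (j.strictMono (by simpa using hxy))
  have hs : Function.Surjective (Fin.addCases (motive := fun _ => γ) (fun a => f (i a))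
      (fun b => g (j b)) : Fin (m + n) → γ) := by
    intro c
    rcases hsurj c with ⟨a, rfl⟩ | ⟨b, rfl⟩
    · exact ⟨Fin.castAdd n (i.symm a), by simp⟩
    · exact ⟨Fin.natAdd m (j.symm b), by simp⟩
  let e : Fin (m + n) ≃o γ := hmono.orderIsoOfSurjective _ hs
  have hef : ∀ a, e (Fin.castAdd n a) = f (i a) := fun a => by simp [e]
  have heg : ∀ b, e (Fin.natAdd m b) = g (j b) := fun a => by simp [e]
  rw [← std_fin_comap K P i, ← std_fin_comap K P j, std_mul_std_fin]
  refine (Finset.sum_equiv (comapEquiv e.toEquiv) (fun T => ?_) fun T _ => ?_).symm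
  · simp only [Finset.mem_filter, Finset.mem_univ, true_and]
    refine and_congr (ext_iff'.trans ⟨fun h x y => ?_, fun h x y => ?_⟩)
      (ext_iff'.trans ⟨fun h x y => ?_, fun h x y => ?_⟩)
    · simpa [comap, comapEquiv, hef] using h (i x) (i y)
    · simpa [comap, comapEquiv, hef] using h (i.symm x) (i.symm y)
    · simpa [comap, comapEquiv, heg] using h (j x) (j y)
    · simpa [comap, comapEquiv, heg] using h (j.symm x) (j.symm y)
  · exact (std_fin_comap K P e T).symm

/-- Both sides equal the sum over the relations on `a + b + c` points with prescribed restrictions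
to three consecutive intervals. -/
lemma std_mul_assoc {a b c : ℕ} (R : IRel a) (S : IRel b) (U : IRel c) :
    std K P R * std K P S * std K P U = std K P R * (std K P S * std K P U) := by
  classical
  let fa : Fin a → Fin (a + b + c) := fun i => ⟨i, by omega⟩
  let fb : Fin b → Fin (a + b + c) := fun i => ⟨a + i, by omega⟩
  let fc : Fin c → Fin (a + b + c) := fun i => ⟨a + b + i, by omega⟩
  let fab : Fin (a + b) → Fin (a + b + c) := fun i => ⟨i, by omega⟩
  let fbc : Fin (b + c) → Fin (a + b + c) := fun i => ⟨a + i, by omega⟩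
  trans ∑ V : ReflRel (Fin (a + b + c)) with
    (V.comap fa = R ∧ V.comap fb = S) ∧ V.comap fc = U, std K P V
  · rw [std_mul_std K P (f := Fin.castAdd b) (g := Fin.natAdd a) (Fin.strictMono_castAdd _)
      (Fin.strictMono_natAdd _) (fun x y => by simp [Fin.lt_def]; omega) (fun x => by
        induction x using Fin.addCases <;> simp), Finset.sum_mul]
    refine (Eq.trans ?_ (sum_comap_eq fab
      (fun T => T.comap (Fin.castAdd b) = R ∧ T.comap (Fin.natAdd a) = S)
      (fun V => V.comap fc = U) (std K P))).trans
      (Finset.sum_congr (by ext; simp only [Finset.mem_filter]; rfl) fun _ _ => rfl)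
    refine Finset.sum_congr (by ext; simp) fun T _ => ?_
    refine (std_mul_std K P (f := fab) (g := fc) (fun x y h => h) ?_ ?_ ?_ _ _).trans
      (Finset.sum_congr (by ext; simp) fun _ _ => rfl)
    · intro x y h; simpa [fc] using h
    · intro x y; simp [fab, fc, Fin.lt_def]; omega
    · intro x
      by_cases h : x.1 < a + b
      · exact Or.inl ⟨⟨x, h⟩, rfl⟩
      · exact Or.inr ⟨⟨x - (a + b), by omega⟩, by ext; simp [fc]; omega⟩
  · rw [std_mul_std K P (α := Fin b) (β := Fin c) (f := Fin.castAdd c) (g := Fin.natAdd b)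
      (Fin.strictMono_castAdd _)
      (Fin.strictMono_natAdd _) (fun x y => by simp [Fin.lt_def]; omega) (fun x => by
        induction x using Fin.addCases <;> simp), Finset.mul_sum]
    have hc : ∀ V : ReflRel (Fin (a + b + c)), V.comap fc = (V.comap fbc).comap (Fin.natAdd b) := by
      intro V; ext i j; simp [comap, fc, fbc, add_assoc]
    have hb : ∀ V : ReflRel (Fin (a + b + c)), V.comap fb = (V.comap fbc).comap (Fin.castAdd c) :=
      fun _ => rfl
    refine Eq.trans (Finset.sum_congr ?_ fun _ _ => rfl) (sum_comap_eq fbc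
      (fun T => T.comap (Fin.castAdd c) = S ∧ T.comap (Fin.natAdd b) = U)
      (fun V => V.comap fa = R) (std K P)).symm |>.trans ?_
    · ext; simp only [Finset.mem_filter, hb, hc]; tauto
    refine Finset.sum_congr (by ext; simp) fun T _ => ?_
    rw [std_mul_std K P (f := fa) (g := fbc) (fun x y h => h) ?_ ?_ ?_]
    · exact Finset.sum_congr (by ext; simp; tauto) fun _ _ => rfl
    · intro x y h; simpa [fbc] using h
    · intro x y; simp [fa, fbc, Fin.lt_def]; omega
    · intro x
      by_cases h : x.1 < a
      · exact Or.inl ⟨⟨x, h⟩, rfl⟩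
      · exact Or.inr ⟨⟨x - a, by omega⟩, by ext; simp [fbc]; omega⟩

end Product

end HopfSpan

section HopfSpan

variable (K : Type u) [Field K] (P : Family)

variable {α β γ : Type*} [LinearOrder α] [Finite α] [LinearOrder β] [Finite β]
  [LinearOrder γ] [Finite γ]

variable {K P} in
lemma hopfSpan_induction {p : HopfSpan K P → Prop} (x : HopfSpan K P) (zero : p 0)
    (std : ∀ n (R : IRel n), p (std K P R)) (add : ∀ x y, p x → p y → p (x + y))
    (smul : ∀ (c : K) x, p x → p (c • x)) : p x := by
  refine Finsupp.induction_linear (motive := p) x zero add fun ⟨n, R, hR⟩ c => ?_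
  have := smul c _ (std n R)
  rw [std_fin, F_single K hR] at this
  change p (c • (Finsupp.single _ 1 : KSpan K P)) at this
  rwa [Finsupp.smul_single_one] at this

lemma smul_mul_hopfSpan (c : K) (x y : HopfSpan K P) : (c • x) * y = c • (x * y) :=
  LinearMap.map_smul₂ (product K P) c x y

lemma mul_smul_hopfSpan (c : K) (x y : HopfSpan K P) : x * (c • y) = c • (x * y) :=
  map_smul (product K P x) c y

/-! ### The ring structure -/

noncomputable instance : One (HopfSpan K P) := ⟨unit K P⟩

lemma std_eq_one (R : ReflRel α) [IsEmpty α] : std K P R = 1 := by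
  rw [← std_fin_comap K P (OrderIso.ofIsEmpty (Fin 0) α), std_fin]
  change F K P _ = F K P _
  congr 1
  ext i
  exact i.elim0

lemma stdOn_empty (T : ReflRel α) : stdOn K P T ∅ = 1 := std_eq_one K P _

variable [IsHopfFamily P]

noncomputable instance : Ring (HopfSpan K P) where
  __ := (inferInstance : NonUnitalNonAssocRing (HopfSpan K P))
  mul_assoc x y z := by
    induction x using hopfSpan_induction with
    | zero => simp only [zero_mul]
    | add _ _ h h' => simp only [add_mul, h, h']
    | smul c _ h => simp only [smul_mul_hopfSpan, h]
    | std a R =>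
      induction y using hopfSpan_induction with
      | zero => simp only [zero_mul, mul_zero]
      | add _ _ h h' => simp only [add_mul, mul_add, h, h']
      | smul c _ h => simp only [smul_mul_hopfSpan, mul_smul_hopfSpan, h]
      | std b S =>
        induction z using hopfSpan_induction with
        | zero => simp only [mul_zero]
        | add _ _ h h' => simp only [mul_add, h, h']
        | smul c _ h => simp only [mul_smul_hopfSpan, h]
        | std c U => exact std_mul_assoc K P R S U
  one_mul x := by
    classical
    induction x using hopfSpan_induction with
    | zero => simp only [mul_zero]
    | add _ _ h h' => simp only [mul_add, h, h']
    | smul c _ h => simp only [mul_smul_hopfSpan, h]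
    | std a R =>
      rw [← std_eq_one K P (⟨fun _ _ => True, fun _ => trivial⟩ : IRel 0),
        std_mul_std K P (f := Fin.elim0) (g := id) (fun i => i.elim0) strictMono_id
          (fun i => i.elim0) (fun i => Or.inr ⟨i, rfl⟩)]
      refine (Finset.sum_congr (s₂ := {R}) ?_ fun _ _ => rfl).trans (Finset.sum_singleton _ _)
      ext T
      rw [Finset.mem_filter, Finset.mem_singleton]
      simp only [Finset.mem_univ, true_and, comap_id]
      exact and_iff_right (ReflRel.ext fun i => i.elim0)
  mul_one x := by
    classical
    induction x using hopfSpan_induction with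
    | zero => simp only [zero_mul]
    | add _ _ h h' => simp only [add_mul, h, h']
    | smul c _ h => simp only [smul_mul_hopfSpan, h]
    | std a R =>
      rw [← std_eq_one K P (⟨fun _ _ => True, fun _ => trivial⟩ : IRel 0),
        std_mul_std K P (g := Fin.elim0) (f := id) strictMono_id (fun i => i.elim0)
          (fun _ i => i.elim0) (fun i => Or.inl ⟨i, rfl⟩)]
      refine (Finset.sum_congr (s₂ := {R}) ?_ fun _ _ => rfl).trans (Finset.sum_singleton _ _)
      ext T
      rw [Finset.mem_filter, Finset.mem_singleton]
      simp only [Finset.mem_univ, true_and, comap_id]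
      exact and_iff_left (ReflRel.ext fun i => i.elim0)

noncomputable instance : Algebra K (HopfSpan K P) :=
  Algebra.ofModule (smul_mul_hopfSpan K P) (mul_smul_hopfSpan K P)

/-! ### The coalgebra structure -/

omit [IsHopfFamily P] in
lemma F_restrict {n : ℕ} (R : IRel n) (X : Finset (Fin n)) :
    F K P (restrict R X) = stdOn K P R X := by
  have := std_comap K P (X.orderEmbOfFin rfl).strictMono R
  rw [Finset.range_orderEmbOfFin] at this
  rw [← this, std_fin]
  rfl

open scoped Classical in
-- If `R` is outside `P`, closure under gluing forces one part of every total cut of `R` outside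
-- `P`, and all terms vanish.
lemma coproduct_F {n : ℕ} (R : IRel n) : coproduct K P (F K P R) =
    ∑ X : Finset (Fin n) with IsTotalCut R X,
      F K P (restrict R X) ⊗ₜ[K] F K P (restrict R Xᶜ) := by
  classical
  by_cases hR : R ∈ P n
  · simp [F_single K hR, coproduct]
  · rw [F_of_notMem K P hR, map_zero, Finset.sum_eq_zero]
    intro X hX
    rw [Finset.mem_filter] at hX
    by_cases h1 : restrict R X ∈ P _
    · by_cases h2 : restrict R Xᶜ ∈ P _
      · refine absurd ?_ hR
        refine IsHopfFamily.mem_of_cut (X.orderEmbOfFin rfl) (Xᶜ.orderEmbOfFin rfl)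
          (X.orderEmbOfFin rfl).strictMono (Xᶜ.orderEmbOfFin rfl).strictMono (fun i => ?_)
          (fun i j => hX.2 _ (by simp) _ ?_) h1 h2
        · simp only [Finset.range_orderEmbOfFin, Finset.mem_coe, Finset.mem_compl]
          exact em _
        · exact Finset.mem_compl.1 (by simp)
      · rw [F_of_notMem K P h2, TensorProduct.tmul_zero]
    · rw [F_of_notMem K P h1, TensorProduct.zero_tmul]

noncomputable instance : CoalgebraStruct K (HopfSpan K P) where
  comul := coproduct K P
  counit := counit K P

open Coalgebra

open scoped Classical in
lemma comul_std_fin {n : ℕ} (R : IRel n) : comul (R := K) (std K P R) =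
    ∑ X : Finset (Fin n) with IsTotalCut R X, stdOn K P R X ⊗ₜ[K] stdOn K P R (Xᶜ : Set (Fin n)) := by
  rw [std_fin]
  refine (coproduct_F K P R).trans (Finset.sum_congr (by ext; simp) fun X _ => ?_)
  rw [F_restrict, F_restrict, Finset.coe_compl]
  rfl

open scoped Classical in
-- All parts remain subsets of the one order `α`, so iterated coproducts become sums over chains of
-- subsets.
lemma comul_stdOn (T : ReflRel α) (X : Set α) : comul (R := K) (stdOn K P T X) =
    ∑ A : Set α with A ⊆ X ∧ T.IsCut A (X \ A), stdOn K P T A ⊗ₜ[K] stdOn K P T (X \ A) := by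
  obtain ⟨n, ⟨i⟩⟩ := exists_orderIso_fin X
  let f : Fin n → α := fun j => (i j).1
  have hf : StrictMono f := fun a b h => i.strictMono h
  have hX : Set.range f = X := by
    ext x; exact ⟨fun ⟨j, hj⟩ => hj ▸ (i j).2, fun h => ⟨i.symm ⟨x, h⟩, by simp [f]⟩⟩
  have hc : ∀ A : Set (Fin n), f '' Aᶜ = X \ f '' A := by
    intro A; rw [Set.image_compl_eq_range_sdiff_image hf.injective, hX]
  rw [← hX, ← std_comap K P hf, comul_std_fin, hX]
  refine Finset.sum_bij (fun A _ => f '' A) ?_ ?_ ?_ ?_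
  · intro A hA
    rw [Finset.mem_filter] at hA ⊢
    refine ⟨Finset.mem_univ _, hX ▸ Set.image_subset_range _ _, ?_⟩
    rw [← hc]
    rintro _ ⟨x, hx, rfl⟩ _ ⟨y, hy, rfl⟩
    exact hA.2 x hx y hy
  · intro A _ B _ h
    exact Finset.coe_injective (hf.injective.image_injective h)
  · intro A hA
    rw [Finset.mem_filter] at hA
    have hA' : f '' (f ⁻¹' A) = A := by
      rw [Set.image_preimage_eq_inter_range, hX, Set.inter_eq_left.2 hA.2.1]
    refine ⟨(f ⁻¹' A).toFinset, ?_, by simpa using hA'⟩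
    rw [Finset.mem_filter]
    refine ⟨Finset.mem_univ _, fun x hx y hy => ?_⟩
    refine hA.2.2 _ (by simpa using hx) _ ⟨(i y).2, by simpa using hy⟩
  · intro A _
    rw [stdOn_comap K P hf, stdOn_comap K P hf, hc]

open scoped Classical in
lemma comul_std (T : ReflRel α) : comul (R := K) (std K P T) =
    ∑ A : Set α with T.IsCut A Aᶜ, stdOn K P T A ⊗ₜ[K] stdOn K P T Aᶜ := by
  rw [← stdOn_univ, comul_stdOn]
  simp [Set.compl_eq_univ_sdiff]

open scoped Classical in
lemma counit_std (T : ReflRel α) : CoalgebraStruct.counit (R := K) (std K P T) = if IsEmpty α then 1 else 0 := by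
  obtain ⟨n, ⟨i⟩⟩ := exists_orderIso_fin α
  rw [← std_fin_comap K P i, std_fin, ← i.toEquiv.isEmpty_congr]
  change counit K P _ = _
  by_cases h : comap i T ∈ P n
  · rcases n.eq_zero_or_pos with rfl | hn
    · have : IsEmpty (Fin 0) := inferInstance
      simp [F_single K h, counit, this]
    · have : NeZero n := ⟨hn.ne'⟩
      simp [F_single K h, counit, hn.ne']
  -- The size is not `0` here, because the empty relation belongs to `P`.
  · rw [F_of_notMem K P h, map_zero, if_neg]
    rintro he
    obtain rfl : n = 0 := by
      by_contra hn
      exact he.false (⟨0, Nat.pos_of_ne_zero hn⟩ : Fin n)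
    exact h (IsHopfFamily.empty_mem _)

open scoped Classical in
lemma counit_stdOn (T : ReflRel α) (X : Set α) :
    CoalgebraStruct.counit (R := K) (stdOn K P T X) = if X = ∅ then 1 else 0 := by
  rw [stdOn, counit_std]
  simp [Set.isEmpty_coe_sort]

/-- Both sides run over the ordered decompositions into three parts in which each part is totally
cut from the later ones. The left side records the union `B` of the first two parts and then the
first part `A`; the right side records `A` and then `C = B \ A`. -/
lemma hopfSpan_coassoc (T : ReflRel α) :
    TensorProduct.assoc K _ _ _ (comul.rTensor (HopfSpan K P) (comul (R := K) (std K P T))) =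
      comul.lTensor (HopfSpan K P) (comul (R := K) (std K P T)) := by
  classical
  rw [← stdOn_univ, comul_stdOn]
  simp only [map_sum, LinearMap.rTensor_tmul, LinearMap.lTensor_tmul, comul_stdOn,
    TensorProduct.sum_tmul, TensorProduct.tmul_sum, TensorProduct.assoc_tmul, Finset.sum_sigma']
  refine Finset.sum_bij' (fun s _ => ⟨s.2, s.1 \ s.2⟩) (fun s _ => ⟨s.1 ∪ s.2, s.1⟩) ?_ ?_ ?_ ?_ ?_
  · rintro ⟨B, A⟩ h
    simp only [Finset.mem_sigma, Finset.mem_filter, Finset.mem_univ, true_and,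
      Set.subset_univ, IsCut, Set.mem_sdiff, and_imp] at h ⊢
    obtain ⟨h1, h2, h3⟩ := h
    refine ⟨fun x hx y _ hy => ?_, fun y hy => ⟨trivial, hy.2⟩, fun x hx hx' y _ hy hy' => ?_⟩
    · by_cases hB : y ∈ B
      · exact h3 x hx y hB hy
      · exact h1 x (h2 hx) y trivial hB
    · exact h1 x hx y trivial fun hB => hy' ⟨hB, hy⟩
  · rintro ⟨A, C⟩ h
    simp only [Finset.mem_sigma, Finset.mem_filter, Finset.mem_univ, true_and,
      Set.subset_univ, IsCut, Set.mem_sdiff, and_imp, Set.mem_union, not_or] at h ⊢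
    obtain ⟨h1, h2, h3⟩ := h
    refine ⟨?_, Set.subset_union_left, fun x hx y _ hy' => h1 x hx y trivial hy'⟩
    rintro x (hx | hx) y - hy hy'
    · exact h1 x hx y trivial hy
    · exact h3 x hx y trivial hy hy'
  · rintro ⟨B, A⟩ h
    simp only [Finset.mem_sigma, Finset.mem_filter] at h
    simp [Set.union_eq_right.2 h.2.2.1]
  · rintro ⟨A, C⟩ h
    simp only [Finset.mem_sigma, Finset.mem_filter] at h
    have : Disjoint C A := (Set.subset_sdiff.1 h.2.2.1).2
    simp [Set.union_sdiff_left, this.sdiff_eq_left]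
  · rintro ⟨B, A⟩ h
    simp only [Finset.mem_sigma, Finset.mem_filter] at h
    have : (Set.univ \ A) \ (B \ A) = Set.univ \ B := by
      ext x; have := @h.2.2.1 x; simp; tauto
    simp [this]

noncomputable instance : Coalgebra K (HopfSpan K P) where
  coassoc := hopfSpan_lhom_ext fun n R => hopfSpan_coassoc K P R
  rTensor_counit_comp_comul := hopfSpan_lhom_ext fun n R => by
    classical
    simp only [LinearMap.comp_apply, comul_std, map_sum, LinearMap.rTensor_tmul, counit_stdOn]
    rw [Finset.sum_eq_single ∅]
    · simp [stdOn_univ]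
    · intro A _ hA
      simp [hA]
    · intro h
      simp [IsCut] at h
  lTensor_counit_comp_comul := hopfSpan_lhom_ext fun n R => by
    classical
    simp only [LinearMap.comp_apply, comul_std, map_sum, LinearMap.lTensor_tmul, counit_stdOn]
    rw [Finset.sum_eq_single Set.univ]
    · simp [stdOn_univ]
    · intro A _ hA
      simp [hA]
    · intro h
      simp [IsCut] at h

end HopfSpan

/-! ### Gluing two relations along a total cut -/

section Glue

variable {α γ : Type*}

namespace ReflRel

/-- The relation with total cut `(Z, Zᶜ)` and with given restrictions to `Z` and `Zᶜ`. -/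
def glue (Z : Set γ) (A : ReflRel Z) (B : ReflRel ↥Zᶜ) : ReflRel γ :=
  ⟨fun u v => (∃ (hu : u ∈ Z) (hv : v ∈ Z), A.1 ⟨u, hu⟩ ⟨v, hv⟩) ∨ (u ∈ Z ∧ v ∉ Z) ∨
    (∃ (hu : u ∉ Z) (hv : v ∉ Z), B.1 ⟨u, hu⟩ ⟨v, hv⟩), fun u => by
      by_cases hu : u ∈ Z
      · exact Or.inl ⟨hu, hu, A.2 _⟩
      · exact Or.inr (Or.inr ⟨hu, hu, B.2 _⟩)⟩

variable {Z : Set γ} (A : ReflRel Z) (B : ReflRel ↥Zᶜ)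

lemma glue_restr : (glue Z A B).restr Z = A := by
  ext ⟨i, hi⟩ ⟨j, hj⟩
  simp [glue, restr, comap]

lemma glue_restr_compl : (glue Z A B).restr Zᶜ = B := by
  ext ⟨i, hi⟩ ⟨j, hj⟩
  rw [Set.mem_compl_iff] at hi hj
  simp [glue, restr, comap, hi, hj]

lemma isCut_glue : (glue Z A B).IsCut Z Zᶜ := by
  intro x hx y hy
  rw [Set.mem_compl_iff] at hy
  simp [glue, hx, hy]

lemma glue_of_isCut {T : ReflRel γ} (h : T.IsCut Z Zᶜ) : glue Z (T.restr Z) (T.restr Zᶜ) = T := by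
  ext i j
  by_cases hi : i ∈ Z <;> by_cases hj : j ∈ Z <;> simp [glue, restr, comap, hi, hj]
  · exact (h i hi j hj).1
  · exact (h j hj i hi).2

/-- Pulling back commutes with gluing. A prescribed pullback `R` therefore means a total cut of `R`
together with prescribed pullbacks of the two parts. -/
lemma comap_glue (f : α → γ) (R : ReflRel α) :
    (glue Z A B).comap f = R ↔ R.IsCut (f ⁻¹' Z) (f ⁻¹' Z)ᶜ ∧
      A.comap (fun x : f ⁻¹' Z => ⟨f x, x.2⟩) = R.restr (f ⁻¹' Z) ∧
      B.comap (fun x : ↥(f ⁻¹' Z)ᶜ => ⟨f x, x.2⟩) = R.restr (f ⁻¹' Z)ᶜ := by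
  constructor
  · rintro rfl
    refine ⟨fun x hx y hy => isCut_glue A B _ hx _ hy, ?_, ?_⟩
    · conv_lhs => rw [← glue_restr A B]
      rfl
    · conv_lhs => rw [← glue_restr_compl A B]
      rfl
  · rintro ⟨h, hA, hB⟩
    rw [ext_iff'] at hA hB
    rw [← glue_of_isCut h]
    ext i j
    by_cases hi : f i ∈ Z <;> by_cases hj : f j ∈ Z <;> simp [glue, comap, hi, hj]
    · exact hA ⟨i, hi⟩ ⟨j, hj⟩
    · exact hB ⟨i, hi⟩ ⟨j, hj⟩

open scoped Classical in
/-- A sum over the relations with a given total cut. -/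
lemma sum_isCut {M : Type*} [AddCommMonoid M] [Finite γ] (Z : Set γ) (h : ReflRel γ → M) :
    ∑ T : ReflRel γ with T.IsCut Z Zᶜ, h T =
      ∑ A : ReflRel Z, ∑ B : ReflRel ↥Zᶜ, h (glue Z A B) := by
  rw [← Fintype.sum_prod_type']
  refine Finset.sum_bij' (fun T _ => (T.restr Z, T.restr Zᶜ)) (fun p _ => glue Z p.1 p.2)
    ?_ ?_ ?_ ?_ ?_
  · simp
  · intro p _
    simpa using isCut_glue p.1 p.2
  · intro T hT
    exact glue_of_isCut (Finset.mem_filter.1 hT).2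
  · intro p _
    exact Prod.ext (glue_restr _ _) (glue_restr_compl _ _)
  · intro T hT
    rw [glue_of_isCut (Finset.mem_filter.1 hT).2]

end ReflRel

end Glue

/-! ### Compatibility of the product with the coproduct, and the bialgebra -/

section HopfSpan

variable (K : Type u) [Field K] (P : Family) [IsHopfFamily P]

open Coalgebra

lemma sum_preimage_finAppend {M : Type*} [AddCommMonoid M] {m n : ℕ}
    (h : Set (Fin m) → Set (Fin n) → M) :
    ∑ X : Set (Fin m), ∑ Y : Set (Fin n), h X Y =
      ∑ Z : Set (Fin (m + n)), h (Fin.castAdd n ⁻¹' Z) (Fin.natAdd m ⁻¹' Z) := by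
  rw [← Fintype.sum_prod_type']
  symm
  refine Function.Bijective.sum_comp (e := fun Z : Set (Fin (m + n)) =>
    (Fin.castAdd n ⁻¹' Z, Fin.natAdd m ⁻¹' Z)) ⟨fun Z Z' hZ => ?_, fun p => ?_⟩ (fun p => h p.1 p.2)
  · rw [Prod.mk.injEq] at hZ
    ext x
    induction x using Fin.addCases with
    | left x => exact Set.ext_iff.1 hZ.1 x
    | right x => exact Set.ext_iff.1 hZ.2 x
  · refine ⟨{z | Fin.addCases (fun x => x ∈ p.1) (fun y => y ∈ p.2) z}, ?_⟩
    ext x <;> simp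

open scoped Classical in
-- The elements of `Z` in the first `m` positions form an initial part of `Z`, so `std_mul_std`
-- applies inside `Z`.
lemma stdOn_mul_stdOn {m n : ℕ} (R : IRel m) (S : IRel n) (Z : Set (Fin (m + n))) :
    stdOn K P R (Fin.castAdd n ⁻¹' Z) * stdOn K P S (Fin.natAdd m ⁻¹' Z) =
      ∑ A : ReflRel Z, if
        A.comap (fun x : Fin.castAdd n ⁻¹' Z => ⟨Fin.castAdd n x, x.2⟩) = restr R _ ∧
        A.comap (fun x : Fin.natAdd m ⁻¹' Z => ⟨Fin.natAdd m x, x.2⟩) = restr S _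
      then std K P A else 0 := by
  rw [stdOn, stdOn, ← Finset.sum_filter]
  refine std_mul_std K P ?_ ?_ ?_ ?_ _ _
  · intro x y h; exact h
  · rintro ⟨x, hx⟩ ⟨y, hy⟩ h
    exact (Fin.strictMono_natAdd m) h
  · rintro ⟨x, hx⟩ ⟨y, hy⟩
    simp only [Subtype.mk_lt_mk, Fin.lt_def, Fin.val_castAdd, Fin.val_natAdd]
    omega
  · rintro ⟨z, hz⟩
    induction z using Fin.addCases with
    | left x => exact Or.inl ⟨⟨x, hz⟩, rfl⟩
    | right x => exact Or.inr ⟨⟨x, hz⟩, rfl⟩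

/-- Both sides are sums over a set `Z`, a relation `A` on `Z` and a relation `B` on its complement.
On the left, the relation glued from `A` and `B` lies in the shuffle. On the right, `Z` induces
total cuts of `R` and `S`, and `A`, `B` lie in the shuffles of the corresponding parts. These
conditions agree by `comap_glue`. -/
lemma comul_std_mul_std {m n : ℕ} (R : IRel m) (S : IRel n) :
    comul (R := K) (std K P R * std K P S) =
      comul (R := K) (std K P R) * comul (R := K) (std K P S) := by
  classical
  have hmul := std_mul_std K P (f := Fin.castAdd n) (g := Fin.natAdd m) (Fin.strictMono_castAdd _)
      (Fin.strictMono_natAdd _) (fun x y => by simp [Fin.lt_def]; omega) (fun x => by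
        induction x using Fin.addCases <;> simp) R S
  rw [hmul, map_sum]
  simp only [comul_std, Finset.sum_mul_sum, Algebra.TensorProduct.tmul_mul_tmul]
  simp only [Finset.sum_filter (p := fun A : Set (Fin m) => _),
    Finset.sum_filter (p := fun A : Set (Fin n) => _)]
  trans ∑ Z : Set (Fin (m + n)), ∑ T : ReflRel (Fin (m + n)) with T.IsCut Z Zᶜ,
    if T.comap (Fin.castAdd n) = R ∧ T.comap (Fin.natAdd m) = S then
      stdOn K P T Z ⊗ₜ[K] stdOn K P T Zᶜ else 0
  · simp only [Finset.sum_filter]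
    rw [Finset.sum_comm]
    refine Finset.sum_congr rfl fun T _ => ?_
    by_cases h : T.comap (Fin.castAdd n) = R ∧ T.comap (Fin.natAdd m) = S
    · simp only [if_pos h]
    · simp only [if_neg h, ite_self, Finset.sum_const_zero]
  trans ∑ X : Set (Fin m), ∑ Y : Set (Fin n),
    if IsCut R X Xᶜ ∧ IsCut S Y Yᶜ then
      (stdOn K P R X * stdOn K P S Y) ⊗ₜ[K] (stdOn K P R Xᶜ * stdOn K P S Yᶜ) else 0
  · rw [sum_preimage_finAppend]
    refine Finset.sum_congr rfl fun Z _ => ?_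
    rw [sum_isCut]
    simp only [← Set.preimage_compl]
    rw [stdOn_mul_stdOn, stdOn_mul_stdOn, TensorProduct.sum_tmul]
    simp only [TensorProduct.tmul_sum]
    by_cases h : IsCut R (Fin.castAdd n ⁻¹' Z) (Fin.castAdd n ⁻¹' Zᶜ) ∧
        IsCut S (Fin.natAdd m ⁻¹' Z) (Fin.natAdd m ⁻¹' Zᶜ)
    · rw [if_pos h]
      refine Finset.sum_congr rfl fun A _ => Finset.sum_congr rfl fun B _ => ?_
      rw [TensorProduct.tmul_ite, TensorProduct.ite_tmul, ← ite_and]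
      refine if_congr ?_ ?_ rfl
      · have := h.1; have := h.2
        rw [comap_glue, comap_glue]
        simp only [← Set.preimage_compl]
        tauto
      · rw [stdOn, stdOn, glue_restr, glue_restr_compl]
    · rw [if_neg h]
      refine Finset.sum_eq_zero fun A _ => Finset.sum_eq_zero fun B _ => if_neg ?_
      rw [comap_glue, comap_glue]
      exact fun h' => h ⟨h'.1.1, h'.2.1⟩
  · refine Finset.sum_congr rfl fun X _ => ?_
    by_cases h : IsCut R X Xᶜ
    · simp [h]
    · simp [h]

lemma counit_std_mul_std {m n : ℕ} (R : IRel m) (S : IRel n) :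
    CoalgebraStruct.counit (R := K) (std K P R * std K P S) =
      CoalgebraStruct.counit (R := K) (std K P R) * CoalgebraStruct.counit (R := K) (std K P S) := by
  classical
  rcases m.eq_zero_or_pos with rfl | hm
  · rw [std_eq_one K P R, one_mul, ← std_eq_one K P R]
    rw [show CoalgebraStruct.counit (R := K) (std K P R) = 1 from
      (counit_std K P R).trans (if_pos (inferInstance : IsEmpty (Fin 0))), one_mul]
  · have : Nonempty (Fin m) := ⟨⟨0, hm⟩⟩
    have : Nonempty (Fin (m + n)) := ⟨⟨0, by omega⟩⟩
    rw [std_mul_std_fin]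
    simp [counit_std]

noncomputable instance : Bialgebra K (HopfSpan K P) :=
  Bialgebra.mk' K (HopfSpan K P)
    (by
      classical
      rw [← std_eq_one K P (⟨fun _ _ => True, fun _ => trivial⟩ : IRel 0)]
      exact (counit_std K P _).trans (if_pos (inferInstance : IsEmpty (Fin 0))))
    (by
      intro x y
      induction x using hopfSpan_induction with
      | zero => simp only [zero_mul, map_zero]
      | add _ _ h h' => simp only [add_mul, map_add, h, h']
      | smul c _ h => simp only [smul_mul_assoc, map_smul, h]
      | std a R =>
        induction y using hopfSpan_induction with
        | zero => simp only [mul_zero, map_zero]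
        | add _ _ h h' => simp only [mul_add, map_add, h, h']
        | smul c _ h => simp only [mul_smul_comm, map_smul, h]
        | std b S => exact counit_std_mul_std K P R S)
    (by
      classical
      rw [← std_eq_one K P (⟨fun _ _ => True, fun _ => trivial⟩ : IRel 0)]
      refine (comul_std K P _).trans ?_
      rw [Finset.sum_eq_single ∅]
      · rw [stdOn_empty, Set.compl_empty, stdOn_univ, std_eq_one, Algebra.TensorProduct.one_def]
      · intro A _ hA
        exact absurd (Set.eq_empty_of_isEmpty A) hA
      · intro h
        exact absurd (Finset.mem_filter.2 ⟨Finset.mem_univ _, fun x hx => hx.elim⟩) h)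
    (by
      intro x y
      induction x using hopfSpan_induction with
      | zero => simp only [zero_mul, map_zero]
      | add _ _ h h' => simp only [add_mul, map_add, h, h']
      | smul c _ h => simp only [smul_mul_assoc, map_smul, h]
      | std a R =>
        induction y using hopfSpan_induction with
        | zero => simp only [mul_zero, map_zero]
        | add _ _ h h' => simp only [mul_add, map_add, h, h']
        | smul c _ h => simp only [mul_smul_comm, map_smul, h]
        | std b S => exact comul_std_mul_std K P R S)

/-! ### The antipode -/

open WithConv

/-- The difference of the unit and the identity in the convolution algebra. -/
noncomputable def oneSubId : WithConv (HopfSpan K P →ₗ[K] HopfSpan K P) :=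
  1 - toConv LinearMap.id

open scoped Classical in
lemma conv_mul_stdOn {α : Type*} [LinearOrder α] [Finite α]
    (f g : WithConv (HopfSpan K P →ₗ[K] HopfSpan K P)) (T : ReflRel α) (X : Set α) :
    (f * g) (stdOn K P T X) = ∑ A : Set α with A ⊆ X ∧ T.IsCut A (X \ A),
      f (stdOn K P T A) * g (stdOn K P T (X \ A)) := by
  rw [LinearMap.convMul_apply, comul_stdOn]
  simp

/-- Since `1 - id` kills the unit, each of the `k` convolution factors must consume at least one
element of `X`. -/
lemma oneSubId_pow_stdOn {α : Type*} [LinearOrder α] [Finite α] (T : ReflRel α) (k : ℕ) :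
    ∀ X : Set α, X.ncard < k → (oneSubId K P ^ k) (stdOn K P T X) = 0 := by
  classical
  induction k with
  | zero => intro X hX; omega
  | succ k ih =>
    intro X hX
    rw [pow_succ', conv_mul_stdOn]
    refine Finset.sum_eq_zero fun A hA => ?_
    rw [Finset.mem_filter] at hA
    rcases A.eq_empty_or_nonempty with rfl | hne
    · have : oneSubId K P (stdOn K P T ∅) = 0 := by
        rw [stdOn_empty]
        change algebraMap K (HopfSpan K P) (CoalgebraStruct.counit (R := K) (1 : HopfSpan K P)) - 1 = 0
        simp
      rw [this, zero_mul]
    · have : (X \ A).ncard < X.ncard := by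
        refine Set.ncard_lt_ncard ⟨Set.sdiff_subset, fun h => ?_⟩ X.toFinite
        obtain ⟨a, ha⟩ := hne
        exact (h (hA.2.1 ha)).2 ha
      rw [ih _ (by omega), mul_zero]

/-- The partial sums of the geometric series for the convolution inverse of the identity. -/
noncomputable def antipodeSum (n : ℕ) : WithConv (HopfSpan K P →ₗ[K] HopfSpan K P) :=
  ∑ k ∈ Finset.range n, oneSubId K P ^ k

/-- The antipode of `K P`. -/
noncomputable def hopfAntipode : HopfSpan K P →ₗ[K] HopfSpan K P :=
  Finsupp.linearCombination K fun T : Σ n, P n =>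
    antipodeSum K P (T.1 + 1) (std K P T.2.1)

/-- The terms of index greater than the size vanish by `oneSubId_pow_stdOn`. One number of terms
thus serves all the parts in a coproduct at once. -/
lemma antipodeSum_stdOn {α : Type*} [LinearOrder α] [Finite α] (T : ReflRel α) (X : Set α)
    {n : ℕ} (hn : X.ncard < n) :
    antipodeSum K P n (stdOn K P T X) = antipodeSum K P (X.ncard + 1) (stdOn K P T X) := by
  have hs : ∀ m, antipodeSum K P m (stdOn K P T X) =
      ∑ k ∈ Finset.range m, (oneSubId K P ^ k) (stdOn K P T X) := by
    intro m
    induction m with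
    | zero => rfl
    | succ m ih =>
      rw [Finset.sum_range_succ, ← ih, antipodeSum, Finset.sum_range_succ]
      rfl
  rw [hs, hs]
  symm
  refine Finset.sum_subset (Finset.range_mono hn) fun k _ hk => ?_
  exact oneSubId_pow_stdOn K P T k X (by rw [Finset.mem_range] at hk; omega)

lemma hopfAntipode_std {m n : ℕ} (hn : m < n) (R : IRel m) :
    hopfAntipode K P (std K P R) = antipodeSum K P n (std K P R) := by
  have h := antipodeSum_stdOn K P R Set.univ (n := n) (by simpa [Set.ncard_univ] using hn)
  rw [stdOn_univ, Set.ncard_univ, Nat.card_fin] at h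
  rw [h]
  by_cases hR : R ∈ P m
  · conv_lhs => rw [std_fin, F_single K hR]
    refine (Finsupp.linearCombination_single ..).trans ?_
    rw [one_smul]
  · have : std K P R = 0 := (std_fin K P R).trans (F_of_notMem K P hR)
    rw [this, map_zero]
    exact (map_zero (antipodeSum K P (m + 1)).ofConv).symm

lemma hopfAntipode_stdOn {α : Type*} [LinearOrder α] [Finite α] (T : ReflRel α) (X : Set α)
    {n : ℕ} (hn : X.ncard < n) :
    hopfAntipode K P (stdOn K P T X) = antipodeSum K P n (stdOn K P T X) := by
  obtain ⟨m, ⟨i⟩⟩ := exists_orderIso_fin X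
  rw [stdOn, ← std_fin_comap K P i]
  refine hopfAntipode_std K P ?_ _
  rwa [← Nat.card_coe_set_eq, ← Nat.card_congr i.toEquiv, Nat.card_fin] at hn

/-- With `x = 1 - id`, the geometric sum times `1 - x = id` is `1 - x ^ (n + 1)`, and the last power
vanishes in size `n`. The parts in the coproduct have size at most `n`, so the antipode acts on them
by this same partial sum. -/
lemma hopfAntipode_mul_id : toConv (hopfAntipode K P) * toConv LinearMap.id = 1 := by
  classical
  refine WithConv.ext (hopfSpan_lhom_ext fun n R => ?_)
  have h : antipodeSum K P (n + 1) * toConv LinearMap.id = 1 - oneSubId K P ^ (n + 1) := by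
    rw [← geom_sum_mul_neg, oneSubId, sub_sub_cancel]
    rfl
  have h' := congrArg (fun f => f (stdOn K P R Set.univ)) h
  have h0 := oneSubId_pow_stdOn K P R (n + 1) Set.univ (by simp [Set.ncard_univ])
  have h1 : (1 - oneSubId K P ^ (n + 1)) (stdOn K P R Set.univ) =
      (1 : WithConv (HopfSpan K P →ₗ[K] HopfSpan K P)) (stdOn K P R Set.univ) := by
    change _ - (oneSubId K P ^ (n + 1)) (stdOn K P R Set.univ) = _
    rw [h0, sub_zero]
    rfl
  change (toConv (hopfAntipode K P) * toConv LinearMap.id :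
      WithConv (HopfSpan K P →ₗ[K] HopfSpan K P)) (std K P R) =
    (1 : WithConv (HopfSpan K P →ₗ[K] HopfSpan K P)) (std K P R)
  rw [← stdOn_univ, ← h1, ← h', conv_mul_stdOn, conv_mul_stdOn]
  refine Finset.sum_congr rfl fun A _ => ?_
  congr 1
  refine hopfAntipode_stdOn K P R A (Nat.lt_succ_of_le ?_)
  simpa [Set.ncard_univ] using Set.ncard_le_ncard A.subset_univ

lemma id_mul_hopfAntipode : toConv LinearMap.id * toConv (hopfAntipode K P) = 1 := by
  classical
  refine WithConv.ext (hopfSpan_lhom_ext fun n R => ?_)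
  have h : toConv LinearMap.id * antipodeSum K P (n + 1) = 1 - oneSubId K P ^ (n + 1) := by
    rw [← mul_neg_geom_sum, oneSubId, sub_sub_cancel]
    rfl
  have h' := congrArg (fun f => f (stdOn K P R Set.univ)) h
  have h0 := oneSubId_pow_stdOn K P R (n + 1) Set.univ (by simp [Set.ncard_univ])
  have h1 : (1 - oneSubId K P ^ (n + 1)) (stdOn K P R Set.univ) =
      (1 : WithConv (HopfSpan K P →ₗ[K] HopfSpan K P)) (stdOn K P R Set.univ) := by
    change _ - (oneSubId K P ^ (n + 1)) (stdOn K P R Set.univ) = _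
    rw [h0, sub_zero]
    rfl
  change (toConv LinearMap.id * toConv (hopfAntipode K P) :
      WithConv (HopfSpan K P →ₗ[K] HopfSpan K P)) (std K P R) =
    (1 : WithConv (HopfSpan K P →ₗ[K] HopfSpan K P)) (std K P R)
  rw [← stdOn_univ, ← h1, ← h', conv_mul_stdOn, conv_mul_stdOn]
  refine Finset.sum_congr rfl fun A _ => ?_
  congr 1
  refine hopfAntipode_stdOn K P R _ (Nat.lt_succ_of_le ?_)
  simpa [Set.ncard_univ] using Set.ncard_le_ncard (Set.univ \ A).subset_univ

noncomputable instance : HopfAlgebra K (HopfSpan K P) where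
  antipode := hopfAntipode K P
  mul_antipode_rTensor_comul := congrArg WithConv.ofConv (hopfAntipode_mul_id K P)
  mul_antipode_lTensor_comul := congrArg WithConv.ofConv (id_mul_hopfAntipode K P)

end HopfSpan

/-! ### The deletion map -/

section Deletion

variable {α β γ : Type*} [LinearOrder α] [LinearOrder β] [LinearOrder γ]

namespace ReflRel

/-- The TOIP deletion of a relation on a linear order. -/
def del (R : ReflRel α) : ReflRel α :=
  ⟨fun u v => R.1 u v ∧ ¬ (∃ b, u < b ∧ b < v ∧ ¬ R.1 b v) ∧ ¬ (∃ b, v < b ∧ b < u ∧ ¬ R.1 b v),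
    fun i => ⟨R.2 i, fun ⟨_, h, h', _⟩ => lt_asymm h h', fun ⟨_, h, h', _⟩ => lt_asymm h h'⟩⟩

/-- Both deletion rules test pairs `(b, v)` with the same second entry `v`. Hence `u` stays below
`v` when the whole stretch from `u` up to, but excluding, `v` is below `v`. -/
lemma del_apply (R : ReflRel α) (u v : α) :
    R.del.1 u v ↔ ∀ b, (u ≤ b ∧ b < v ∨ v < b ∧ b ≤ u) → R.1 b v := by
  constructor
  · rintro ⟨h, h1, h2⟩ b (⟨hb, hb'⟩ | ⟨hb, hb'⟩)
    · rcases hb.eq_or_lt with rfl | hb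
      · exact h
      · by_contra hR; exact h1 ⟨b, hb, hb', hR⟩
    · rcases hb'.eq_or_lt with rfl | hb'
      · exact h
      · by_contra hR; exact h2 ⟨b, hb, hb', hR⟩
  · intro h
    refine ⟨?_, ?_, ?_⟩
    · rcases lt_trichotomy u v with huv | rfl | huv
      · exact h u (Or.inl ⟨le_rfl, huv⟩)
      · exact R.2 u
      · exact h u (Or.inr ⟨huv, le_rfl⟩)
    · rintro ⟨b, hb, hb', hR⟩
      exact hR (h b (Or.inl ⟨hb.le, hb'⟩))
    · rintro ⟨b, hb, hb', hR⟩
      exact hR (h b (Or.inr ⟨hb, hb'.le⟩))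

/-- Whether a pair survives depends only on the elements between its entries, and a map with convex
range misses none of them. -/
lemma del_comap {f : α → β} (hf : StrictMono f)
    (hconv : ∀ a b c, f a < c → c < f b → c ∈ Set.range f) (T : ReflRel β) :
    (T.comap f).del = T.del.comap f := by
  ext u v
  rw [del_apply]
  refine Iff.trans ?_ (del_apply _ _ _).symm
  constructor
  · rintro h b hb
    have hb' : b ∈ Set.range f := by
      rcases hb with ⟨h1, h2⟩ | ⟨h1, h2⟩
      · rcases h1.eq_or_lt with rfl | h1
        · exact ⟨u, rfl⟩
        · exact hconv _ _ _ h1 h2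
      · rcases h2.eq_or_lt with rfl | h2
        · exact ⟨u, rfl⟩
        · exact hconv _ _ _ h1 h2
    obtain ⟨b, rfl⟩ := hb'
    refine h b ?_
    simpa [hf.lt_iff_lt, hf.le_iff_le] using hb
  · intro h b hb
    refine h (f b) ?_
    simpa [hf.lt_iff_lt, hf.le_iff_le] using hb

/-- The deletion of a relation with a given total cut is determined by the deletions of the two
parts. -/
lemma del_glue_congr {Z : Set γ} {A A' : ReflRel Z} {B B' : ReflRel ↥Zᶜ} (hA : A.del = A'.del)
    (hB : B.del = B'.del) : (glue Z A B).del = (glue Z A' B').del := by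
  suffices H : ∀ {A A' : ReflRel Z} {B B' : ReflRel ↥Zᶜ}, A.del = A'.del → B.del = B'.del →
      ∀ u v, (glue Z A B).del.1 u v → (glue Z A' B').del.1 u v from
    ReflRel.ext fun u v => ⟨H hA hB u v, H hA.symm hB.symm u v⟩
  intro A A' B B' hA hB u v h
  rw [del_apply] at h ⊢
  intro b hb
  -- The stretch from `b` to `v` is contained in the one from `u` to `v`.
  have key : ∀ b' , (b ≤ b' ∧ b' < v ∨ v < b' ∧ b' ≤ b) → (glue Z A B).1 b' v := by
    intro b' hb'
    refine h b' ?_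
    rcases hb with ⟨h1, h2⟩ | ⟨h1, h2⟩ <;> rcases hb' with ⟨h3, h4⟩ | ⟨h3, h4⟩
    · exact Or.inl ⟨h1.trans h3, h4⟩
    · exact absurd (h3.trans_le h4) (by simpa using h2.le)
    · exact absurd (h3.trans_lt h4) (by simpa using h1.le)
    · exact Or.inr ⟨h3, h4.trans h2⟩
  have hbb : (glue Z A B).1 b v := h b hb
  -- If `b` and `v` are on the same side, `key` shows that the pair survives the deletion of that
  -- part, which is common to both gluings. Across the cut, the gluing alone decides.
  by_cases hv : v ∈ Z <;> by_cases hbZ : b ∈ Z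
  · have : A.del.1 ⟨b, hbZ⟩ ⟨v, hv⟩ := by
      rw [del_apply]
      rintro ⟨c, hc⟩ hcb
      have := key c (by simpa using hcb)
      simpa [glue, hc, hv] using this
    rw [hA] at this
    exact Or.inl ⟨hbZ, hv, this.1⟩
  · simp [glue, hv, hbZ] at hbb
  · exact Or.inr (Or.inl ⟨hbZ, hv⟩)
  · have : B.del.1 ⟨b, hbZ⟩ ⟨v, hv⟩ := by
      rw [del_apply]
      rintro ⟨c, hc⟩ hcb
      have hc' : c ∉ Z := hc
      have := key c (by simpa using hcb)
      simpa [glue, hc', hv] using this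
    rw [hB] at this
    exact Or.inr (Or.inr ⟨hbZ, hv, this.1⟩)

end ReflRel

end Deletion

/-- `Q` is the image of the family `P` by the TOIP deletion. -/
structure IsDeletionImage (P Q : Family) : Prop where
  del_mem : ∀ {n : ℕ} {R : IRel n}, R ∈ P n → toipDeletion R ∈ Q n
  exists_del_eq : ∀ {n : ℕ} {T : IRel n}, T ∈ Q n → ∃ R ∈ P n, toipDeletion R = T

/-! ### The fiber sums: independence, product and coproduct -/

section HopfSpan

variable (K : Type u) [Field K] {P Q : Family}

/-- Membership in `P` can be dropped from the index set, since `F` vanishes outside `P`. -/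
lemma fiberSum_eq_sum {n : ℕ} (T : IRel n) :
    fiberSum K P T = ∑ R : IRel n with del R = T, F K P R := by
  classical
  trans ∑ R : IRel n with R ∈ P n ∧ toipDeletion R = T, F K P R
  · unfold fiberSum
    congr!
  rw [Finset.sum_filter, Finset.sum_filter]
  refine Finset.sum_congr rfl fun R _ => ?_
  by_cases hR : R ∈ P n
  · have : (R ∈ P n ∧ toipDeletion R = T) ↔ del R = T := and_iff_right hR
    by_cases h : del R = T
    · rw [if_pos h, if_pos (this.2 h)]
    · rw [if_neg h, if_neg (mt this.1 h)]
  · rw [F_of_notMem K P hR, ite_self, ite_self]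

open scoped Classical in
lemma fiberSum_apply {n m : ℕ} (T : IRel n) (R : IRel m) (hR : R ∈ P m) :
    fiberSum K P T ⟨m, ⟨R, hR⟩⟩ =
      if (⟨n, T⟩ : Σ n, IRel n) = ⟨m, toipDeletion R⟩ then 1 else 0 := by
  rw [fiberSum_eq_sum, Finsupp.finsetSum_apply]
  by_cases h : n = m
  · subst h
    have : ∀ R' : IRel n, F K P R' ⟨n, ⟨R, hR⟩⟩ = if R' = R then 1 else 0 := by
      intro R'
      by_cases h' : R' ∈ P n
      · rw [F_single K h', Finsupp.single_apply]
        exact if_congr (by simp) rfl rfl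
      · rw [F_of_notMem K P h', if_neg (fun h => h' (by rw [h]; exact hR)), Finsupp.zero_apply]
    simp only [this, Finset.sum_ite_eq', Finset.mem_filter, Finset.mem_univ, true_and,
      Sigma.mk.injEq, heq_eq_eq]
    exact if_congr eq_comm rfl rfl
  · rw [if_neg (by simp [h]), Finset.sum_eq_zero]
    intro R' _
    by_cases h' : R' ∈ P n
    · rw [F_single K h', Finsupp.single_apply, if_neg (by simp [h])]
    · rw [F_of_notMem K P h', Finsupp.zero_apply]

/-- The fibers are disjoint, so the coordinate at any `R` in `P` over `T` isolates the coefficient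
of the fiber sum of `T`. -/
lemma linearIndependent_fiberSum (hQ : IsDeletionImage P Q) :
    LinearIndependent K fun T : Σ n, Q n => fiberSum K P T.2.1 := by
  classical
  rw [linearIndependent_iff']
  intro s g hg ⟨n, T, hT⟩ hi
  obtain ⟨R, hR, rfl⟩ := hQ.exists_del_eq hT
  have := DFunLike.congr_fun hg ⟨n, ⟨R, hR⟩⟩
  simp only [Finsupp.finsetSum_apply, Finsupp.smul_apply, fiberSum_apply, smul_eq_mul, mul_ite,
    mul_one, mul_zero, Finsupp.zero_apply] at this
  rw [Finset.sum_eq_single_of_mem _ hi] at this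
  · simpa using this
  · rintro ⟨m, T', hT'⟩ _ hne
    refine if_neg fun h => hne ?_
    simp only [Sigma.mk.injEq] at h
    obtain ⟨rfl, h⟩ := h
    obtain rfl := eq_of_heq h
    rfl

variable (P Q) in
/-- The span of the sums over the fibers of the deletion map. -/
noncomputable def fiberSubmodule : Submodule K (HopfSpan K P) :=
  Submodule.span K (Set.range fun T : Σ n, Q n => (fiberSum K P T.2.1 : HopfSpan K P))

open scoped Classical in
-- When the standardization of `T` is outside `Q`, no relation of `P` lies over it and the sum is
-- zero.
lemma sum_del_eq_mem (hQ : IsDeletionImage P Q) {α : Type*} [LinearOrder α] [Finite α]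
    (T : ReflRel α) : ∑ R : ReflRel α with R.del = T, std K P R ∈ fiberSubmodule K P Q := by
  obtain ⟨n, ⟨i⟩⟩ := exists_orderIso_fin α
  have : ∑ R : ReflRel α with R.del = T, std K P R = fiberSum K P (T.comap i) := by
    trans (∑ R : IRel n with toipDeletion R = comap i T, std K P R : HopfSpan K P)
    · refine Finset.sum_equiv (comapEquiv i.toEquiv) (fun R => ?_)
        fun R _ => (std_fin_comap K P i R).symm
      simp only [Finset.mem_filter, Finset.mem_univ, true_and]
      have := del_comap i.strictMono (fun _ _ c _ _ => i.surjective c) R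
      change _ ↔ del (comap i R) = _
      rw [this]
      exact (comapEquiv i.toEquiv).injective.eq_iff.symm
    · rw [fiberSum_eq_sum]
      exact Finset.sum_congr rfl fun R _ => std_fin K P R
  rw [this]
  by_cases hT : comap i T ∈ Q n
  · exact Submodule.subset_span ⟨⟨n, ⟨_, hT⟩⟩, rfl⟩
  · have h0 : fiberSum K P (comap i T) = 0 := by
      rw [fiberSum_eq_sum, Finset.sum_eq_zero]
      intro R hR
      refine F_of_notMem K P fun h => hT ?_
      rw [← (Finset.mem_filter.1 hR).2]
      exact hQ.del_mem h
    rw [h0]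
    exact Submodule.zero_mem _

open scoped Classical in
lemma sum_mem_fiberSubmodule (hQ : IsDeletionImage P Q) {α : Type*} [LinearOrder α] [Finite α]
    (c : ReflRel α → Prop) (hc : ∀ R S, R.del = S.del → c R → c S) :
    ∑ R : ReflRel α with c R, std K P R ∈ fiberSubmodule K P Q := by
  rw [← Finset.sum_fiberwise (g := del)]
  refine Submodule.sum_mem _ fun T _ => ?_
  by_cases h : ∃ S : ReflRel α, S.del = T ∧ c S
  · obtain ⟨S, rfl, hS⟩ := h
    convert sum_del_eq_mem K hQ S.del using 2
    ext R
    simp only [Finset.mem_filter, Finset.mem_univ, true_and]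
    exact ⟨fun h => h.2, fun h => ⟨hc S R h.symm hS, h⟩⟩
  · rw [Finset.sum_eq_zero]
    · exact Submodule.zero_mem _
    · intro R hR
      simp only [Finset.mem_filter, Finset.mem_univ, true_and] at hR
      exact absurd ⟨R, hR.2, hR.1⟩ h

open scoped Classical in
lemma sum_tmul_mem_fiberSubmodule (hQ : IsDeletionImage P Q) {α β : Type*} [LinearOrder α]
    [Finite α] [LinearOrder β] [Finite β] (c : ReflRel α → ReflRel β → Prop)
    (hc : ∀ A A' B B', A.del = A'.del → B.del = B'.del → c A B → c A' B') :
    ∑ A : ReflRel α, ∑ B : ReflRel β, (if c A B then std K P A ⊗ₜ[K] std K P B else 0) ∈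
      LinearMap.range (TensorProduct.map (fiberSubmodule K P Q).subtype
        (fiberSubmodule K P Q).subtype) := by
  rw [← Finset.sum_fiberwise (g := del)]
  refine Submodule.sum_mem _ fun T _ => ?_
  rw [Finset.sum_comm, ← Finset.sum_fiberwise (g := del)]
  refine Submodule.sum_mem _ fun U _ => ?_
  by_cases h : ∃ A B, del A = T ∧ del B = U ∧ c A B
  · obtain ⟨A, B, rfl, rfl, hAB⟩ := h
    refine ⟨⟨_, sum_del_eq_mem K hQ A.del⟩ ⊗ₜ ⟨_, sum_del_eq_mem K hQ B.del⟩, ?_⟩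
    rw [TensorProduct.map_tmul, Submodule.subtype_apply, Submodule.subtype_apply,
      TensorProduct.tmul_sum]
    simp only [TensorProduct.sum_tmul]
    refine Finset.sum_congr rfl fun B' hB' => Finset.sum_congr rfl fun A' hA' => ?_
    rw [Finset.mem_filter] at hA' hB'
    rw [if_pos (hc A A' B B' hA'.2.symm hB'.2.symm hAB)]
  · rw [Finset.sum_eq_zero]
    · exact Submodule.zero_mem _
    · intro B hB
      refine Finset.sum_eq_zero fun A hA => if_neg fun hAB => h ⟨A, B, ?_, ?_, hAB⟩
      · exact (Finset.mem_filter.1 hA).2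
      · exact (Finset.mem_filter.1 hB).2

lemma fiberSubmodule_induction {p : (x : HopfSpan K P) → x ∈ fiberSubmodule K P Q → Prop}
    (zero : p 0 (Submodule.zero_mem _))
    (sum : ∀ n (T : IRel n) h, p (∑ R : IRel n with del R = T, std K P R) h)
    (add : ∀ x y hx hy, p x hx → p y hy → p (x + y) (Submodule.add_mem _ hx hy))
    (smul : ∀ (c : K) x hx, p x hx → p (c • x) (Submodule.smul_mem _ c hx))
    {x : HopfSpan K P} (hx : x ∈ fiberSubmodule K P Q) : p x hx := by
  refine Submodule.span_induction (p := p) ?_ zero add smul hx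
  rintro _ ⟨⟨n, T, hT⟩, rfl⟩
  have : (∑ R : IRel n with del R = T, std K P R) = fiberSum K P T := by
    rw [fiberSum_eq_sum]
    exact Finset.sum_congr rfl fun R _ => std_fin K P R
  have h := sum n T
  rw [this] at h
  exact h _

variable [IsHopfFamily P]

omit [IsHopfFamily P] in
lemma one_mem_fiberSubmodule (hQ : IsDeletionImage P Q) : 1 ∈ fiberSubmodule K P Q := by
  classical
  have := sum_mem_fiberSubmodule K hQ (fun _ : IRel 0 => True) (fun _ _ _ h => h)
  rw [Finset.filter_true, Finset.sum_eq_single_of_mem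
    (⟨fun _ _ => True, fun _ => trivial⟩ : IRel 0) (Finset.mem_univ _) fun R _ hR =>
      absurd (ReflRel.ext fun i => i.elim0) hR, std_eq_one] at this
  exact this

/-- The product of two fiber sums runs over the `V` whose restrictions to an initial and a final
interval have given deletions. By `del_comap` this depends only on the deletion of `V`. -/
lemma mul_mem_fiberSubmodule (hQ : IsDeletionImage P Q) {x y : HopfSpan K P}
    (hx : x ∈ fiberSubmodule K P Q) (hy : y ∈ fiberSubmodule K P Q) :
    x * y ∈ fiberSubmodule K P Q := by
  classical
  induction hx using fiberSubmodule_induction with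
  | zero => rw [zero_mul]; exact Submodule.zero_mem _
  | add x y _ _ hx hy => rw [add_mul]; exact Submodule.add_mem _ hx hy
  | smul c x _ hx => rw [smul_mul_assoc]; exact Submodule.smul_mem _ _ hx
  | sum m T _ =>
    induction hy using fiberSubmodule_induction with
    | zero => rw [mul_zero]; exact Submodule.zero_mem _
    | add x y _ _ hx hy => rw [mul_add]; exact Submodule.add_mem _ hx hy
    | smul c x _ hx => rw [mul_smul_comm]; exact Submodule.smul_mem _ _ hx
    | sum n S _ =>
      have key : (∑ R : IRel m with del R = T, std K P R) * (∑ R : IRel n with del R = S, std K P R)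
          = ∑ V : ReflRel (Fin (m + n)) with
            (V.comap (Fin.castAdd n)).del = T ∧ (V.comap (Fin.natAdd m)).del = S, std K P V := by
        refine Eq.trans ?_ (sum_comap_eq (Fin.castAdd n) (fun R : IRel m => del R = T)
          (fun V => (V.comap (Fin.natAdd m)).del = S) (std K P))
        rw [Finset.sum_mul]
        refine Finset.sum_congr rfl fun R _ => ?_
        rw [Finset.mul_sum]
        trans ∑ V : ReflRel (Fin (m + n)) with
          (V.comap (Fin.natAdd m)).del = S ∧ V.comap (Fin.castAdd n) = R, std K P V
        · refine Eq.trans ?_ (sum_comap_eq (Fin.natAdd m) (fun R : IRel n => del R = S)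
            (fun V => V.comap (Fin.castAdd n) = R) (std K P))
          refine Finset.sum_congr rfl fun R' _ => ?_
          rw [std_mul_std K P (f := Fin.castAdd n) (g := Fin.natAdd m) (Fin.strictMono_castAdd _)
            (Fin.strictMono_natAdd _) (fun x y => by simp [Fin.lt_def]; omega) (fun x => by
              induction x using Fin.addCases <;> simp)]
          exact Finset.sum_congr (by ext; simp [and_comm]) fun _ _ => rfl
        · exact Finset.sum_congr (by ext; simp [and_comm]) fun _ _ => rfl
      rw [key]
      convert sum_mem_fiberSubmodule K hQ (fun V : ReflRel (Fin (m + n)) =>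
        (V.comap (Fin.castAdd n)).del = T ∧ (V.comap (Fin.natAdd m)).del = S) ?_
      intro V V' h
      have h1 := fun V : ReflRel (Fin (m + n)) => del_comap (Fin.strictMono_castAdd n)
        (fun a b c _ h => ⟨⟨c, by simp [Fin.lt_def] at h; omega⟩, rfl⟩) V
      have h2 := fun V : ReflRel (Fin (m + n)) => del_comap (Fin.strictMono_natAdd m)
        (fun a b c h _ => ⟨⟨c - m, by simp [Fin.lt_def] at h; omega⟩,
          by ext; simp [Fin.lt_def] at h ⊢; omega⟩) V
      simp only [h1, h2, h, imp_self]

/-- For a fixed set `Z`, the pairs `(A, B)` that occur are selected by a condition on their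
deletions alone, by `del_glue_congr`. -/
lemma comul_mem_fiberSubmodule (hQ : IsDeletionImage P Q) {x : HopfSpan K P}
    (hx : x ∈ fiberSubmodule K P Q) :
    Coalgebra.comul (R := K) x ∈ LinearMap.range (TensorProduct.map
      (fiberSubmodule K P Q).subtype (fiberSubmodule K P Q).subtype) := by
  classical
  induction hx using fiberSubmodule_induction with
  | zero => rw [map_zero]; exact Submodule.zero_mem _
  | add x y _ _ hx hy => rw [map_add]; exact Submodule.add_mem _ hx hy
  | smul c x _ hx => rw [map_smul]; exact Submodule.smul_mem _ _ hx
  | sum n T _ =>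
    have : Coalgebra.comul (R := K) (∑ R : IRel n with del R = T, std K P R) =
        ∑ Z : Set (Fin n), ∑ A : ReflRel Z, ∑ B : ReflRel ↥Zᶜ,
          if (glue Z A B).del = T then std K P A ⊗ₜ[K] std K P B else 0 := by
      trans ∑ Z : Set (Fin n), ∑ R : ReflRel (Fin n) with R.IsCut Z Zᶜ,
        if R.del = T then stdOn K P R Z ⊗ₜ[K] stdOn K P R Zᶜ else 0
      · rw [map_sum, Finset.sum_filter]
        simp only [Finset.sum_filter]
        rw [Finset.sum_comm]
        refine Finset.sum_congr rfl fun R _ => ?_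
        by_cases h : del R = T
        · simp only [if_pos h, comul_std, Finset.sum_filter]
        · simp only [if_neg h, ite_self, Finset.sum_const_zero]
      · refine Finset.sum_congr rfl fun Z _ => ?_
        rw [sum_isCut]
        simp only [stdOn, glue_restr, glue_restr_compl]
    rw [this]
    refine Submodule.sum_mem _ fun Z _ => ?_
    exact sum_tmul_mem_fiberSubmodule K hQ (fun A B => (glue Z A B).del = T)
      fun A A' B B' hA hB h => (del_glue_congr hA hB).symm.trans h

/-! ### Stability of the fiber span under the antipode -/

open WithConv

lemma conv_mul_mem_fiberSubmodule (hQ : IsDeletionImage P Q)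
    {f g : WithConv (HopfSpan K P →ₗ[K] HopfSpan K P)}
    (hf : ∀ x ∈ fiberSubmodule K P Q, f x ∈ fiberSubmodule K P Q)
    (hg : ∀ x ∈ fiberSubmodule K P Q, g x ∈ fiberSubmodule K P Q) :
    ∀ x ∈ fiberSubmodule K P Q, (f * g) x ∈ fiberSubmodule K P Q := by
  intro x hx
  obtain ⟨t, ht⟩ := comul_mem_fiberSubmodule K hQ hx
  rw [LinearMap.convMul_apply, ← ht]
  clear ht
  induction t using TensorProduct.induction_on with
  | zero => simp
  | add a b ha hb => simpa using Submodule.add_mem _ ha hb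
  | tmul a b => simpa using mul_mem_fiberSubmodule K hQ (hf _ a.2) (hg _ b.2)

lemma oneSubId_pow_mem_fiberSubmodule (hQ : IsDeletionImage P Q) (k : ℕ) :
    ∀ x ∈ fiberSubmodule K P Q, (oneSubId K P ^ k) x ∈ fiberSubmodule K P Q := by
  have h1 : ∀ x ∈ fiberSubmodule K P Q,
      (1 : WithConv (HopfSpan K P →ₗ[K] HopfSpan K P)) x ∈ fiberSubmodule K P Q := by
    intro x _
    rw [LinearMap.convOne_apply, Algebra.algebraMap_eq_smul_one]
    exact Submodule.smul_mem _ _ (one_mem_fiberSubmodule K hQ)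
  induction k with
  | zero => exact h1
  | succ k ih =>
    rw [pow_succ']
    refine conv_mul_mem_fiberSubmodule K hQ (fun x hx => ?_) ih
    exact Submodule.sub_mem _ (h1 x hx) hx

lemma antipodeSum_mem_fiberSubmodule (hQ : IsDeletionImage P Q) (n : ℕ) :
    ∀ x ∈ fiberSubmodule K P Q, antipodeSum K P n x ∈ fiberSubmodule K P Q := by
  intro x hx
  induction n with
  | zero => exact Submodule.zero_mem _
  | succ n ih =>
    rw [antipodeSum, Finset.sum_range_succ]
    exact Submodule.add_mem _ ih (oneSubId_pow_mem_fiberSubmodule K hQ n x hx)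

/-- A fiber sum is homogeneous, so the antipode acts on it as one polynomial in `1 - id`, and
stability under product and coproduct passes to convolution powers. -/
lemma hopfAntipode_mem_fiberSubmodule (hQ : IsDeletionImage P Q) {x : HopfSpan K P}
    (hx : x ∈ fiberSubmodule K P Q) : hopfAntipode K P x ∈ fiberSubmodule K P Q := by
  classical
  induction hx using fiberSubmodule_induction with
  | zero => rw [map_zero]; exact Submodule.zero_mem _
  | add x y _ _ hx hy => rw [map_add]; exact Submodule.add_mem _ hx hy
  | smul c x _ hx => rw [map_smul]; exact Submodule.smul_mem _ _ hx
  | sum n T _ =>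
    have : hopfAntipode K P (∑ R : IRel n with del R = T, std K P R) =
        antipodeSum K P (n + 1) (∑ R : IRel n with del R = T, std K P R) := by
      rw [map_sum]
      refine Eq.trans ?_ (map_sum (antipodeSum K P (n + 1)).ofConv _ _).symm
      exact Finset.sum_congr rfl fun R _ => hopfAntipode_std K P n.lt_succ_self R
    rw [this]
    exact antipodeSum_mem_fiberSubmodule K hQ _ _ (sum_del_eq_mem K hQ T)

/-- The sums over the fibers of the deletion map define a Hopf subalgebra. -/
theorem definesHopfSubalgebra_of_isDeletionImage (hQ : IsDeletionImage P Q) :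
    DefinesHopfSubalgebra K P Q where
  linearIndependent := linearIndependent_fiberSum K hQ
  isHopfSubalgebra :=
    { one_mem := one_mem_fiberSubmodule K hQ
      mul_mem := fun _ hx _ hy => mul_mem_fiberSubmodule K hQ hx hy
      comul_mem := fun _ hx => comul_mem_fiberSubmodule K hQ hx
      -- `HopfSpan` is `KSpan` by definition and carries the given operations, so the identity
      -- serves as `e`.
      hopf := ⟨HopfSpan K P, inferInstance, inferInstance, LinearEquiv.refl K (KSpan K P),
        fun _ _ => rfl, rfl, fun x =>
          (LinearMap.congr_fun (TensorProduct.map_id (R := K) (M := KSpan K P) (N := KSpan K P))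
            (coproduct K P x)).symm, fun _ => rfl,
        fun _ hx => hopfAntipode_mem_fiberSubmodule K hQ hx⟩ }

end HopfSpan

/-! ### The weak order families in terms of labelings -/

/-- Labels need not fill an initial segment of `ℕ`; sorting recovers the permutation. This freedom
makes restricting and gluing immediate. -/
lemma mem_WOEP_iff {n : ℕ} {R : IRel n} :
    R ∈ WOEP n ↔ ∃ f : Fin n → ℕ, f.Injective ∧ ∀ u v, R.1 u v ↔ f u ≤ f v := by
  constructor
  · rintro ⟨σ, h⟩
    exact ⟨fun u => σ.symm u, Fin.val_injective.comp σ.symm.injective, h⟩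
  · rintro ⟨f, hf, h⟩
    have hs : StrictMono (f ∘ Tuple.sort f) :=
      (Tuple.monotone_sort f).strictMono_of_injective (hf.comp (Tuple.sort f).injective)
    refine ⟨Tuple.sort f, fun u v => ?_⟩
    rw [h, permRel, ← hs.le_iff_le]
    simp

lemma exists_perm {n : ℕ} {f : Fin n → ℕ} (hf : f.Injective) :
    ∃ σ : Equiv.Perm (Fin n), ∀ u v, σ.symm u < σ.symm v ↔ f u < f v := by
  have hs : StrictMono (f ∘ Tuple.sort f) :=
    (Tuple.monotone_sort f).strictMono_of_injective (hf.comp (Tuple.sort f).injective)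
  refine ⟨Tuple.sort f, fun u v => ?_⟩
  rw [← hs.lt_iff_lt]
  simp

/-- Here `f` and `g` are the positions in the lower and the upper permutation. An increasing pair
lies in all the posets of the interval as soon as the upper permutation, which has the most
inversions, does not invert it; a decreasing pair, as soon as the lower one inverts it. -/
lemma mem_WOIP_iff {n : ℕ} {R : IRel n} :
    R ∈ WOIP n ↔ ∃ f g : Fin n → ℕ, f.Injective ∧ g.Injective ∧
      (∀ a b, a < b → f b < f a → g b < g a) ∧
      ∀ u v, R.1 u v ↔ u = v ∨ (u < v ∧ g u < g v) ∨ (v < u ∧ f u < f v) := by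
  have key : ∀ σ σ' : Equiv.Perm (Fin n), WeakLE σ σ' → ∀ u v : Fin n,
      (∀ τ, WeakLE σ τ → WeakLE τ σ' → permRel τ u v) ↔
        u = v ∨ (u < v ∧ σ'.symm u < σ'.symm v) ∨ (v < u ∧ σ.symm u < σ.symm v) := by
    intro σ σ' hσ u v
    constructor
    · intro h
      rcases lt_trichotomy u v with huv | rfl | huv
      · exact Or.inr (Or.inl ⟨huv, (h σ' hσ subset_rfl).lt_of_ne
          (σ'.symm.injective.ne huv.ne)⟩)
      · exact Or.inl rfl
      · exact Or.inr (Or.inr ⟨huv, (h σ subset_rfl hσ).lt_of_ne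
          (σ.symm.injective.ne huv.ne')⟩)
    · rintro (rfl | ⟨huv, h⟩ | ⟨huv, h⟩) τ h1 h2
      · exact le_refl _
      · by_contra hlt
        have : (u, v) ∈ inversions σ' := h2 ⟨huv, not_le.1 hlt⟩
        exact lt_asymm h this.2
      · have : (v, u) ∈ inversions τ := h1 ⟨huv, h⟩
        exact this.2.le
  constructor
  · rintro ⟨σ, σ', hσ, h⟩
    refine ⟨fun u => σ.symm u, fun u => σ'.symm u, Fin.val_injective.comp σ.symm.injective,
      Fin.val_injective.comp σ'.symm.injective, fun a b hab hf => ?_, fun u v => ?_⟩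
    · have : (a, b) ∈ inversions σ' := hσ ⟨hab, hf⟩
      exact this.2
    · rw [h, key σ σ' hσ]
      rfl
  · rintro ⟨f, g, hf, hg, hfg, h⟩
    obtain ⟨σ, hσ⟩ := exists_perm hf
    obtain ⟨σ', hσ'⟩ := exists_perm hg
    have hle : WeakLE σ σ' := fun p hp => ⟨hp.1, (hσ' _ _).2 (hfg _ _ hp.1 ((hσ _ _).1 hp.2))⟩
    refine ⟨σ, σ', hle, fun u v => ?_⟩
    rw [h, key σ σ' hle, hσ, hσ']

lemma mem_WOFP_iff {n : ℕ} {R : IRel n} :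
    R ∈ WOFP n ↔ ∃ f : Fin n → ℕ, ∀ u v, R.1 u v ↔ u = v ∨ f u < f v := by
  constructor
  · rintro ⟨k, π, -, h⟩
    exact ⟨fun u => π u, h⟩
  · rintro ⟨f, h⟩
    let s := Finset.univ.image f
    have hs : ∀ u, f u ∈ s := fun u => Finset.mem_image_of_mem f (Finset.mem_univ u)
    -- The block of `u` is the rank of `f u` among the labels in use, so no block is empty.
    refine ⟨s.card, fun u => (s.orderIsoOfFin rfl).symm ⟨f u, hs u⟩, fun i => ?_, fun u v => ?_⟩
    · obtain ⟨u, -, hu⟩ := Finset.mem_image.1 (s.orderIsoOfFin rfl i).2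
      exact ⟨u, (s.orderIsoOfFin rfl).symm_apply_eq.2 (Subtype.ext hu)⟩
    · simp [h]

/-- The labeling of a disjoint union in which the labels of the second part come after those of the
first part. -/
lemma exists_labeling_of_cut {k l n : ℕ} {f : Fin k → Fin n} {g : Fin l → Fin n}
    (hf : StrictMono f) (hg : StrictMono g)
    (hne : ∀ i j, f i ≠ g j) (a : Fin k → ℕ) (b : Fin l → ℕ) :
    ∃ c : Fin n → ℕ, (∀ i, c (f i) = a i) ∧ ∃ N, (∀ i, a i < N) ∧ ∀ j, c (g j) = b j + N := by
  classical
  let N := (∑ i, a i) + 1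
  refine ⟨Function.extend f a (Function.extend g (fun j => b j + N) 0),
    fun i => hf.injective.extend_apply _ _ _, N, fun i => ?_, fun j => ?_⟩
  · exact Nat.lt_succ_of_le (Finset.single_le_sum (fun _ _ => Nat.zero_le _) (Finset.mem_univ i))
  · rw [Function.extend_apply' _ _ _ fun ⟨i, hi⟩ => hne i j hi, hg.injective.extend_apply]

lemma ne_of_cut {k l n : ℕ} {T : IRel n} {f : Fin k → Fin n} {g : Fin l → Fin n}
    (hcut : ∀ i j, T.1 (f i) (g j) ∧ ¬ T.1 (g j) (f i)) (i : Fin k) (j : Fin l) : f i ≠ g j :=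
  fun h => (hcut i j).2 (h ▸ (hcut i j).1)

instance : IsHopfFamily WOEP where
  mem_comap f hf h := by
    rw [mem_WOEP_iff] at h ⊢
    obtain ⟨a, ha, h⟩ := h
    exact ⟨a ∘ f, ha.comp hf.injective, fun u v => h _ _⟩
  mem_of_cut {k l n T} f g hf hg hs hcut h1 h2 := by
    rw [mem_WOEP_iff] at h1 h2 ⊢
    obtain ⟨a, ha, h1⟩ := h1
    obtain ⟨b, hb, h2⟩ := h2
    obtain ⟨c, hca, N, hN, hcb⟩ := exists_labeling_of_cut hf hg (ne_of_cut hcut) a b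
    refine ⟨c, fun u v huv => ?_, fun u v => ?_⟩ <;>
      rcases hs u with ⟨u, rfl⟩ | ⟨u, rfl⟩ <;> rcases hs v with ⟨v, rfl⟩ | ⟨v, rfl⟩ <;>
      simp only [hca, hcb] at *
    · rw [ha huv]
    · have := hN u; omega
    · have := hN v; omega
    · rw [hb (by omega : b u = b v)]
    · exact h1 u v
    · have := hN u
      exact iff_of_true (hcut u v).1 (by omega)
    · have := hN v
      exact iff_of_false (hcut v u).2 (by omega)
    · rw [Nat.add_le_add_iff_right]
      exact h2 u v
  empty_mem R := mem_WOEP_iff.2 ⟨0, fun i => i.elim0, fun i => i.elim0⟩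

instance : IsHopfFamily WOFP where
  mem_comap f hf h := by
    rw [mem_WOFP_iff] at h ⊢
    obtain ⟨a, h⟩ := h
    exact ⟨a ∘ f, fun u v => (h _ _).trans (or_congr_left hf.injective.eq_iff)⟩
  mem_of_cut {k l n T} f g hf hg hs hcut h1 h2 := by
    rw [mem_WOFP_iff] at h1 h2 ⊢
    obtain ⟨a, h1⟩ := h1
    obtain ⟨b, h2⟩ := h2
    obtain ⟨c, hca, N, hN, hcb⟩ := exists_labeling_of_cut hf hg (ne_of_cut hcut) a b
    refine ⟨c, fun u v => ?_⟩
    rcases hs u with ⟨u, rfl⟩ | ⟨u, rfl⟩ <;> rcases hs v with ⟨v, rfl⟩ | ⟨v, rfl⟩ <;>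
      simp only [hca, hcb] at *
    · rw [hf.injective.eq_iff]
      exact h1 u v
    · have := hN u
      exact iff_of_true (hcut u v).1 (Or.inr (by omega))
    · have := hN v
      exact iff_of_false (hcut v u).2 (not_or.2 ⟨(ne_of_cut hcut v u).symm, by omega⟩)
    · rw [Nat.add_lt_add_iff_right, hg.injective.eq_iff]
      exact h2 u v
  empty_mem R := mem_WOFP_iff.2 ⟨0, fun i => i.elim0⟩

/-- Both labelings are shifted on the second part, so they order the pairs across the cut alike. -/
instance : IsHopfFamily WOIP where
  mem_comap f hf h := by
    rw [mem_WOIP_iff] at h ⊢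
    obtain ⟨a, b, ha, hb, hab, h⟩ := h
    refine ⟨a ∘ f, b ∘ f, ha.comp hf.injective, hb.comp hf.injective,
      fun u v huv => hab _ _ (hf huv), fun u v => (h _ _).trans ?_⟩
    rw [hf.injective.eq_iff, hf.lt_iff_lt, hf.lt_iff_lt]
    rfl
  mem_of_cut {k l n T} f g hf hg hs hcut h1 h2 := by
    rw [mem_WOIP_iff] at h1 h2 ⊢
    obtain ⟨a, a', ha, ha', haa, h1⟩ := h1
    obtain ⟨b, b', hb, hb', hbb, h2⟩ := h2
    obtain ⟨c, hca, N, hN, hcb⟩ := exists_labeling_of_cut hf hg (ne_of_cut hcut) a b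
    obtain ⟨c', hca', N', hN', hcb'⟩ := exists_labeling_of_cut hf hg (ne_of_cut hcut) a' b'
    refine ⟨c, c', fun u v huv => ?_, fun u v huv => ?_, fun u v huv huv' => ?_, fun u v => ?_⟩ <;>
      rcases hs u with ⟨u, rfl⟩ | ⟨u, rfl⟩ <;> rcases hs v with ⟨v, rfl⟩ | ⟨v, rfl⟩ <;>
      simp only [hca, hcb, hca', hcb'] at *
    · rw [ha huv]
    · have := hN u; omega
    · have := hN v; omega
    · rw [hb (by omega : b u = b v)]
    · rw [ha' huv]
    · have := hN' u; omega
    · have := hN' v; omega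
    · rw [hb' (by omega : b' u = b' v)]
    · exact haa _ _ (hf.lt_iff_lt.1 huv) huv'
    · have := hN u; omega
    · have := hN' v; omega
    · have := hbb _ _ (hg.lt_iff_lt.1 huv) (by omega); omega
    · rw [hf.injective.eq_iff, hf.lt_iff_lt, hf.lt_iff_lt]
      exact h1 u v
    · have := hN u
      have := hN' u
      refine iff_of_true (hcut u v).1 (Or.inr ?_)
      rcases lt_or_gt_of_ne (ne_of_cut hcut u v) with h | h
      · exact Or.inl ⟨h, by omega⟩
      · exact Or.inr ⟨h, by omega⟩
    · have := hN v
      have := hN' v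
      refine iff_of_false (hcut v u).2 ?_
      rintro (h | h | h)
      · exact (ne_of_cut hcut v u).symm h
      · omega
      · omega
    · rw [Nat.add_lt_add_iff_right, Nat.add_lt_add_iff_right, hg.injective.eq_iff, hg.lt_iff_lt,
        hg.lt_iff_lt]
      exact h2 u v
  empty_mem R := mem_WOIP_iff.2 ⟨0, 0, fun i => i.elim0, fun i => i.elim0, fun i => i.elim0,
    fun i => i.elim0⟩

/-! ### Binary trees -/

lemma Descendant.lt : ∀ {t : BinaryTree Unit} {i j : ℕ}, Descendant t i j →
    i < t.numNodes ∧ j < t.numNodes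
  | .node _ l r, i, j, h => by
    simp only [Descendant] at h
    simp only [BinaryTree.numNodes]
    rcases h with ⟨h, h'⟩ | h | ⟨h, h', hr⟩
    · omega
    · have := h.lt; omega
    · have := hr.lt; omega

/-- In the tree `t`, the node `i` is a descendant of `j` if and only if `j` has the greatest label
in the interval between `i` and `j`. -/
def IsTreeLabeling (t : BinaryTree Unit) (f : ℕ → ℕ) : Prop :=
  ∀ i j, i < t.numNodes → j < t.numNodes →
    (Descendant t i j ↔ ∀ k, (i ≤ k ∧ k < j ∨ j < k ∧ k ≤ i) → f k < f j)

/-- The root has the greatest label, so no stretch towards another node `j` may meet it. Hence `i`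
and `j` lie in the same subtree unless `j` is the root. -/
lemma IsTreeLabeling.node {l r : BinaryTree Unit} {f : ℕ → ℕ} (hl : IsTreeLabeling l f)
    (hr : IsTreeLabeling r fun k => f (k + (l.numNodes + 1)))
    (hmax : ∀ k < l.numNodes + r.numNodes + 1, k ≠ l.numNodes → f k < f l.numNodes) :
    IsTreeLabeling (.node () l r) f := by
  intro i j hi hj
  simp only [BinaryTree.numNodes] at hi hj
  simp only [Descendant]
  rcases lt_trichotomy j l.numNodes with hjl | rfl | hjl
  · rcases lt_or_ge i l.numNodes with hil | hil
    · rw [← hl i j hil hjl]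
      refine ⟨?_, fun h => Or.inr (Or.inl h)⟩
      rintro (h | h | h)
      · omega
      · exact h
      · omega
    · refine iff_of_false ?_ fun h => ?_
      · rintro (h | h | h)
        · omega
        · have := h.lt; omega
        · omega
      · have := h l.numNodes (Or.inr ⟨hjl, hil⟩)
        have := hmax j (by omega) hjl.ne
        omega
  · refine iff_of_true (Or.inl ⟨rfl, by omega⟩) fun k hk => hmax k (by omega) (by omega)
  · rcases le_or_gt i l.numNodes with hil | hil
    · refine iff_of_false ?_ fun h => ?_
      · rintro (h | h | h)
        · omega
        · have := h.lt; omega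
        · omega
      · have := h l.numNodes (Or.inl ⟨hil, hjl⟩)
        have := hmax j (by omega) hjl.ne'
        omega
    · have key := hr (i - (l.numNodes + 1)) (j - (l.numNodes + 1)) (by omega) (by omega)
      dsimp only at key
      rw [show j - (l.numNodes + 1) + (l.numNodes + 1) = j by omega] at key
      constructor
      · rintro (h | h | h)
        · omega
        · have := h.lt; omega
        · intro k hk
          have := key.1 h.2.2 (k - (l.numNodes + 1)) (by omega)
          rwa [show k - (l.numNodes + 1) + (l.numNodes + 1) = k by omega] at this
      · intro h
        exact Or.inr (Or.inr ⟨hil, hjl, key.2 fun k hk => h _ (by omega)⟩)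

/-- The binary search tree of an injective labeling. -/
lemma exists_isTreeLabeling (n : ℕ) : ∀ f : ℕ → ℕ, (∀ i < n, ∀ j < n, f i = f j → i = j) →
    ∃ t : BinaryTree Unit, t.numNodes = n ∧ IsTreeLabeling t f := by
  induction n using Nat.strong_induction_on with
  | _ n ih =>
    intro f hf
    rcases n.eq_zero_or_pos with rfl | hn
    · exact ⟨.nil, rfl, fun i j hi => absurd hi (Nat.not_lt_zero _)⟩
    · obtain ⟨m, hm, hmax⟩ := Finset.exists_max_image (Finset.range n) f ⟨0, by simpa⟩
      simp only [Finset.mem_range] at hm hmax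
      obtain ⟨l, hl, hlf⟩ := ih m hm f fun i hi j hj => hf i (by omega) j (by omega)
      obtain ⟨r, hr, hrf⟩ := ih (n - (m + 1)) (by omega) (fun k => f (k + (m + 1)))
        fun i hi j hj h => by have := hf _ (by omega) _ (by omega) h; omega
      subst hl
      refine ⟨.node () l r, by simp only [BinaryTree.numNodes]; omega, hlf.node hrf ?_⟩
      intro k hk hne
      exact (hmax k (by omega)).lt_of_ne fun h => hne (hf _ (by omega) _ hm h)

/-- The labeling of a binary tree in postorder. -/
lemma exists_postorder (t : BinaryTree Unit) : ∃ f : ℕ → ℕ, (∀ k < t.numNodes, f k < t.numNodes) ∧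
    (∀ i < t.numNodes, ∀ j < t.numNodes, f i = f j → i = j) ∧ IsTreeLabeling t f ∧
    ∀ i j, i < j → j < t.numNodes → (f j < f i ↔ Descendant t j i) := by
  induction t with
  | nil => exact ⟨id, by simp [BinaryTree.numNodes, IsTreeLabeling]⟩
  | node _ l r ihl ihr =>
    obtain ⟨f, hf, hfi, hft, hfd⟩ := ihl
    obtain ⟨g, hg, hgi, hgt, hgd⟩ := ihr
    -- A greater node precedes a smaller one only when it is its descendant: the inversions are as
    -- few as the tree allows.
    let h : ℕ → ℕ := fun k => if k < l.numNodes then f k else if k = l.numNodes then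
      l.numNodes + r.numNodes else g (k - (l.numNodes + 1)) + l.numNodes
    have h1 : ∀ k < l.numNodes, h k = f k := fun k hk => if_pos hk
    have h2 : h l.numNodes = l.numNodes + r.numNodes := by simp [h]
    have h3 : ∀ k, l.numNodes < k → h k = g (k - (l.numNodes + 1)) + l.numNodes := fun k hk => by
      simp only [h, if_neg hk.not_gt, if_neg hk.ne']
    have hmax : ∀ k < l.numNodes + r.numNodes + 1, k ≠ l.numNodes → h k < h l.numNodes := by
      intro k hk hne
      rw [h2]
      rcases lt_or_gt_of_ne hne with hlt | hlt
      · rw [h1 k hlt]; have := hf k hlt; omega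
      · rw [h3 k hlt]; have := hg (k - (l.numNodes + 1)) (by omega); omega
    simp only [BinaryTree.numNodes]
    refine ⟨h, fun k hk => ?_, fun i hi j hj hij => ?_, IsTreeLabeling.node ?_ ?_ hmax,
      fun i j hij hj => ?_⟩
    · by_cases hkl : k = l.numNodes
      · subst hkl; rw [h2]; omega
      · have := hmax k hk hkl; omega
    · rcases lt_trichotomy i l.numNodes with hil | rfl | hil
      · rcases lt_trichotomy j l.numNodes with hjl | rfl | hjl
        · rw [h1 i hil, h1 j hjl] at hij
          exact hfi i hil j hjl hij
        · have := hmax i hi hil.ne; omega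
        · rw [h1 i hil, h3 j hjl] at hij
          have := hf i hil; omega
      · by_contra hne
        have := hmax j hj (Ne.symm hne); omega
      · rcases lt_trichotomy j l.numNodes with hjl | rfl | hjl
        · rw [h3 i hil, h1 j hjl] at hij
          have := hf j hjl; omega
        · have := hmax i hi hil.ne'; omega
        · rw [h3 i hil, h3 j hjl] at hij
          have := hgi _ (by omega) _ (by omega) (by omega : g (i - (l.numNodes + 1)) =
            g (j - (l.numNodes + 1)))
          omega
    · intro i j hi hj
      rw [hft i j hi hj, h1 j hj]
      refine forall_congr' fun k => imp_congr_right fun hk => ?_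
      rw [h1 k (by omega)]
    · intro i j hi hj
      rw [hgt i j hi hj]
      refine forall_congr' fun k => imp_congr_right fun hk => ?_
      dsimp only
      rw [h3 _ (by omega), h3 _ (by omega), Nat.add_sub_cancel, Nat.add_sub_cancel]
      omega
    · simp only [Descendant]
      rcases lt_trichotomy i l.numNodes with hil | rfl | hil
      · rcases lt_or_ge j l.numNodes with hjl | hjl
        · rw [h1 i hil, h1 j hjl, hfd i j hij hjl]
          refine ⟨fun h => Or.inr (Or.inl h), ?_⟩
          rintro (h | h | h)
          · omega
          · exact h
          · omega
        · refine iff_of_false ?_ ?_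
          · rcases hjl.eq_or_lt with rfl | hjl
            · rw [h2, h1 i hil]; have := hf i hil; omega
            · rw [h3 j hjl, h1 i hil]; have := hf i hil; omega
          · rintro (h | h | h)
            · omega
            · have := h.lt; omega
            · omega
      · exact iff_of_true (hmax j hj hij.ne') (Or.inl ⟨rfl, by omega⟩)
      · rw [h3 i hil, h3 j (by omega), Nat.add_lt_add_iff_right,
          hgd _ _ (by omega) (by omega)]
        refine ⟨fun h => Or.inr (Or.inr ⟨by omega, hil, h⟩), ?_⟩
        rintro (h | h | h)
        · omega
        · have := h.lt; omega
        · exact h.2.2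

/-- The labeling of a binary tree in which the right subtree of a node comes first, then its left
subtree, then the node. -/
lemma exists_reverse_postorder (t : BinaryTree Unit) : ∃ f : ℕ → ℕ,
    (∀ k < t.numNodes, f k < t.numNodes) ∧
    (∀ i < t.numNodes, ∀ j < t.numNodes, f i = f j → i = j) ∧
    ∀ i j, i < j → j < t.numNodes → (f i < f j ↔ Descendant t i j) := by
  induction t with
  | nil => exact ⟨id, by simp [BinaryTree.numNodes]⟩
  | node _ l r ihl ihr =>
    obtain ⟨f, hf, hfi, hfd⟩ := ihl
    obtain ⟨g, hg, hgi, hgd⟩ := ihr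
    -- A smaller node precedes a greater one only when it is its descendant: the inversions are as
    -- many as the tree allows.
    let h : ℕ → ℕ := fun k => if k < l.numNodes then f k + r.numNodes else if k = l.numNodes then
      l.numNodes + r.numNodes else g (k - (l.numNodes + 1))
    have h1 : ∀ k < l.numNodes, h k = f k + r.numNodes := fun k hk => if_pos hk
    have h2 : h l.numNodes = l.numNodes + r.numNodes := by simp [h]
    have h3 : ∀ k, l.numNodes < k → h k = g (k - (l.numNodes + 1)) := fun k hk => by
      simp only [h, if_neg hk.not_gt, if_neg hk.ne']
    have hmax : ∀ k < l.numNodes + r.numNodes + 1, k ≠ l.numNodes → h k < h l.numNodes := by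
      intro k hk hne
      rw [h2]
      rcases lt_or_gt_of_ne hne with hlt | hlt
      · rw [h1 k hlt]; have := hf k hlt; omega
      · rw [h3 k hlt]; have := hg (k - (l.numNodes + 1)) (by omega); omega
    simp only [BinaryTree.numNodes]
    refine ⟨h, fun k hk => ?_, fun i hi j hj hij => ?_, fun i j hij hj => ?_⟩
    · by_cases hkl : k = l.numNodes
      · subst hkl; rw [h2]; omega
      · have := hmax k hk hkl; omega
    · rcases lt_trichotomy i l.numNodes with hil | rfl | hil
      · rcases lt_trichotomy j l.numNodes with hjl | rfl | hjl
        · rw [h1 i hil, h1 j hjl] at hij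
          exact hfi i hil j hjl (by omega)
        · have := hmax i hi hil.ne; omega
        · rw [h1 i hil, h3 j hjl] at hij
          have := hg (j - (l.numNodes + 1)) (by omega); omega
      · by_contra hne
        have := hmax j hj (Ne.symm hne); omega
      · rcases lt_trichotomy j l.numNodes with hjl | rfl | hjl
        · rw [h3 i hil, h1 j hjl] at hij
          have := hg (i - (l.numNodes + 1)) (by omega); omega
        · have := hmax i hi hil.ne'; omega
        · rw [h3 i hil, h3 j hjl] at hij
          have := hgi _ (by omega) _ (by omega) hij
          omega
    · simp only [Descendant]
      rcases lt_trichotomy j l.numNodes with hjl | rfl | hjl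
      · rw [h1 i (by omega), h1 j hjl, Nat.add_lt_add_iff_right, hfd i j hij hjl]
        refine ⟨fun h => Or.inr (Or.inl h), ?_⟩
        rintro (h | h | h)
        · omega
        · exact h
        · omega
      · exact iff_of_true (hmax i (by omega) hij.ne) (Or.inl ⟨rfl, by omega⟩)
      · rcases le_or_gt i l.numNodes with hil | hil
        · refine iff_of_false ?_ ?_
          · have := hg (j - (l.numNodes + 1)) (by omega)
            rcases hil.eq_or_lt with rfl | hil
            · rw [h2, h3 j hjl]; omega
            · rw [h3 j hjl, h1 i hil]; omega
          · rintro (h | h | h)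
            · omega
            · have := h.lt; omega
            · omega
        · rw [h3 i hil, h3 j hjl, hgd _ _ (by omega) (by omega)]
          refine ⟨fun h => Or.inr (Or.inr ⟨hil, by omega, h⟩), ?_⟩
          rintro (h | h | h)
          · omega
          · have := h.lt; omega
          · exact h.2.2

/-- The deletion of a weak order element poset. -/
lemma del_apply_iff_descendant {n : ℕ} {R : IRel n} {f : ℕ → ℕ} {t : BinaryTree Unit}
    (ht : t.numNodes = n) (hf : IsTreeLabeling t f) {v : Fin n}
    (hR : ∀ b : Fin n, b ≠ v → (R.1 b v ↔ f b < f v)) (u : Fin n) :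
    (toipDeletion R).1 u v ↔ Descendant t u v := by
  subst ht
  rw [hf u v u.2 v.2]
  refine (del_apply _ _ _).trans ⟨fun h k hk => ?_, fun h b hb => ?_⟩
  · have hkn : k < t.numNodes := by omega
    exact (hR ⟨k, hkn⟩ (by simp [Fin.ext_iff]; omega)).1 (h ⟨k, hkn⟩ hk)
  · exact (hR b (by rintro rfl; simp at hb)).2 (h b hb)

/-- The deletion of a labeling's poset is read off its binary search tree, and every tree arises
from its postorder labeling. -/
theorem isDeletionImage_WOEP_TOEP : IsDeletionImage WOEP TOEP where
  del_mem {n R} hR := by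
    obtain ⟨f, hf, h⟩ := mem_WOEP_iff.1 hR
    have hfe : ∀ i : Fin n, Function.extend Fin.val f 0 i = f i :=
      Fin.val_injective.extend_apply _ _
    obtain ⟨t, ht, htf⟩ := exists_isTreeLabeling n (Function.extend Fin.val f 0)
      fun i hi j hj hij => by
        have h1 := hfe ⟨i, hi⟩
        have h2 := hfe ⟨j, hj⟩
        simpa using hf (h1.symm.trans (hij.trans h2))
    refine ⟨t, ht, fun u v => del_apply_iff_descendant ht htf (fun b hb => ?_) u⟩
    rw [h, hfe, hfe]
    exact ⟨fun h => h.lt_of_ne (hf.ne hb), le_of_lt⟩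
  exists_del_eq {n T} hT := by
    obtain ⟨t, rfl, h⟩ := hT
    obtain ⟨f, -, hf, htf, -⟩ := exists_postorder t
    refine ⟨⟨fun u v => f u ≤ f v, fun _ => le_rfl⟩, mem_WOEP_iff.2 ⟨fun u => f u,
      fun u v huv => Fin.ext (hf _ u.2 _ v.2 huv), fun _ _ => Iff.rfl⟩, ReflRel.ext fun u v => ?_⟩
    rw [h]
    refine del_apply_iff_descendant rfl htf (fun b hb => ?_) u
    exact ⟨fun h => h.lt_of_ne fun h' => hb (Fin.ext (hf _ b.2 _ v.2 h')), le_of_lt⟩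

/-! ### The Tamari order in terms of descendants -/

lemma RightRotation.numNodes_eq {t s : BinaryTree Unit} (h : RightRotation t s) :
    s.numNodes = t.numNodes := by
  induction h with
  | root a b c => simp only [BinaryTree.numNodes]; omega
  | left r _ ih => simp only [BinaryTree.numNodes, ih]
  | right l _ ih => simp only [BinaryTree.numNodes, ih]

/-- Let `y` be the root of the rotated tree and `x` its left child. The rotation only removes `x`
and `a` from below `y`, which are increasing pairs, and puts `y` and `c` below `x`, which are
decreasing pairs. -/
lemma RightRotation.descendant_of_lt {t s : BinaryTree Unit} (h : RightRotation t s) :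
    ∀ {i j : ℕ}, i < j → Descendant s i j → Descendant t i j := by
  induction h with
  | root a b c =>
    intro i j hij hd
    simp only [Descendant, BinaryTree.numNodes] at hd ⊢
    rcases hd with h | h | ⟨h1, h2, h | h | ⟨h3, h4, h⟩⟩
    · omega
    · exact Or.inr (Or.inl (Or.inr (Or.inl h)))
    · exact Or.inl (by omega)
    · exact Or.inr (Or.inl (Or.inr (Or.inr ⟨h1, h2, h⟩)))
    · refine Or.inr (Or.inr ⟨by omega, by omega, ?_⟩)
      rw [Nat.sub_sub, Nat.sub_sub] at h
      rwa [show a.numNodes + b.numNodes + 1 + 1 = a.numNodes + 1 + (b.numNodes + 1) by omega]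
  | left r hr ih =>
    intro i j hij hd
    simp only [Descendant, hr.numNodes_eq] at hd ⊢
    exact hd.imp_right (Or.imp_left (ih hij))
  | right l hr ih =>
    intro i j hij hd
    simp only [Descendant, hr.numNodes_eq] at hd ⊢
    exact hd.imp_right (Or.imp_right fun ⟨h1, h2, h⟩ => ⟨h1, h2, ih (by omega) h⟩)

lemma RightRotation.descendant_of_gt {t s : BinaryTree Unit} (h : RightRotation t s) :
    ∀ {i j : ℕ}, j < i → Descendant t i j → Descendant s i j := by
  induction h with
  | root a b c =>
    intro i j hij hd
    simp only [Descendant, BinaryTree.numNodes] at hd ⊢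
    rcases hd with h | (h | h | ⟨h1, h2, h⟩) | ⟨h1, h2, h⟩
    · exact Or.inr (Or.inr ⟨by omega, by omega, Or.inl (by omega)⟩)
    · exact Or.inl (by omega)
    · exact Or.inr (Or.inl h)
    · exact Or.inr (Or.inr ⟨h1, h2, Or.inr (Or.inl h)⟩)
    · refine Or.inr (Or.inr ⟨by omega, by omega, Or.inr (Or.inr ⟨by omega, by omega, ?_⟩)⟩)
      rw [Nat.sub_sub, Nat.sub_sub]
      rwa [show a.numNodes + b.numNodes + 1 + 1 = a.numNodes + 1 + (b.numNodes + 1) by omega] at h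
  | left r hr ih =>
    intro i j hij hd
    simp only [Descendant, hr.numNodes_eq] at hd ⊢
    exact hd.imp_right (Or.imp_left (ih hij))
  | right l hr ih =>
    intro i j hij hd
    simp only [Descendant, hr.numNodes_eq] at hd ⊢
    exact hd.imp_right (Or.imp_right fun ⟨h1, h2, h⟩ => ⟨h1, h2, ih (by omega) h⟩)

namespace TamariLE

variable {t s l l' r r' : BinaryTree Unit}

lemma numNodes_eq (h : TamariLE t s) : s.numNodes = t.numNodes := by
  induction h with
  | refl => rfl
  | tail _ h ih => rw [h.numNodes_eq, ih]

lemma descendant_of_lt (h : TamariLE t s) {i j : ℕ} (hij : i < j) (hd : Descendant s i j) :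
    Descendant t i j := by
  induction h with
  | refl => exact hd
  | tail _ h ih => exact ih (h.descendant_of_lt hij hd)

lemma descendant_of_gt (h : TamariLE t s) {i j : ℕ} (hij : j < i) (hd : Descendant t i j) :
    Descendant s i j := by
  induction h with
  | refl => exact hd
  | tail _ h ih => exact h.descendant_of_gt hij ih

lemma node (hl : TamariLE l l') (hr : TamariLE r r') :
    TamariLE (.node () l r) (.node () l' r') :=
  (Relation.ReflTransGen.lift (fun t => BinaryTree.node () t r)
    (fun _ _ h => RightRotation.left r h) _ _ hl).trans
    (Relation.ReflTransGen.lift (fun t => BinaryTree.node () l' t)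
      (fun _ _ h => RightRotation.right l' h) _ _ hr)

end TamariLE

/-- A node that has all the previous nodes as descendants can be brought to the root by right
rotations. -/
lemma exists_tamariLE_node (t : BinaryTree Unit) : ∀ p < t.numNodes,
    (∀ i < p, Descendant t i p) → ∃ l r : BinaryTree Unit, l.numNodes = p ∧
      TamariLE t (.node () l r) ∧
      (∀ i j, i < j → j < p → Descendant t i j → Descendant l i j) ∧
      ∀ i j, i < j → Descendant t (i + (p + 1)) (j + (p + 1)) → Descendant r i j := by
  induction t with
  | nil => intro p hp; exact absurd hp (Nat.not_lt_zero p)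
  | node _ l r ihl ihr =>
    intro p hp hdesc
    rcases lt_trichotomy p l.numNodes with hpl | rfl | hpl
    · obtain ⟨L, R, hL, hle, hdL, hdR⟩ := ihl p hpl fun i hi => by
        have := hdesc i hi
        simp only [Descendant] at this
        rcases this with h | h | h
        · omega
        · exact h
        · omega
      have hn := hle.numNodes_eq
      simp only [BinaryTree.numNodes] at hn
      -- Once the node `p` is the root of the left subtree, one rotation at the root lifts it.
      refine ⟨L, .node () R r, hL,
        (hle.node .refl).trans (.single (.root L R r)), fun i j hij hj hd => ?_,
        fun i j hij hd => ?_⟩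
      · refine hdL i j hij hj ?_
        simp only [Descendant] at hd
        rcases hd with h | h | h
        · omega
        · exact h
        · omega
      · simp only [Descendant] at hd ⊢
        rcases hd with h | h | ⟨h1, h2, h⟩
        · exact Or.inl (by omega)
        · exact Or.inr (Or.inl (hdR i j hij h))
        · refine Or.inr (Or.inr ⟨by omega, by omega, ?_⟩)
          rwa [show i + (p + 1) - (l.numNodes + 1) = i - (R.numNodes + 1) by omega,
            show j + (p + 1) - (l.numNodes + 1) = j - (R.numNodes + 1) by omega] at h
    · refine ⟨l, r, rfl, .refl, fun i j hij hj hd => ?_, fun i j hij hd => ?_⟩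
      · simp only [Descendant] at hd
        rcases hd with h | h | h
        · omega
        · exact h
        · omega
      · simp only [Descendant] at hd
        rcases hd with h | h | ⟨h1, h2, h⟩
        · omega
        · have := h.lt; omega
        · simpa using h
    -- The root precedes `p` and would be a descendant of it.
    · exfalso
      have := hdesc _ hpl
      simp only [Descendant] at this
      rcases this with h | h | h
      · omega
      · have := h.lt; omega
      · omega

/-- All nodes before the root of `t'` are its descendants in `t'`, hence in `t`, so rotations bring
it to the root of `t`. `exists_tamariLE_node` keeps enough increasing pairs for the induction to
continue in both subtrees. -/
lemma tamariLE_of_descendant (t' : BinaryTree Unit) : ∀ t : BinaryTree Unit,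
    t.numNodes = t'.numNodes → (∀ i j, i < j → Descendant t' i j → Descendant t i j) →
    TamariLE t t' := by
  induction t' with
  | nil =>
    intro t ht _
    cases t with
    | nil => exact .refl
    | node _ l r => simp [BinaryTree.numNodes] at ht
  | node _ l' r' ihl ihr =>
    intro t ht h
    simp only [BinaryTree.numNodes] at ht
    obtain ⟨l, r, hl, hle, hdl, hdr⟩ := exists_tamariLE_node t l'.numNodes (by omega)
      fun i hi => h i _ hi (Or.inl ⟨rfl, by omega⟩)
    have hn := hle.numNodes_eq
    simp only [BinaryTree.numNodes] at hn
    refine hle.trans (TamariLE.node (ihl l hl fun i j hij hd => ?_)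
      (ihr r (by omega) fun i j hij hd => ?_))
    · exact hdl i j hij hd.lt.2 (h i j hij (Or.inr (Or.inl hd)))
    · refine hdr i j hij (h _ _ (by omega) (Or.inr (Or.inr ⟨by omega, by omega, ?_⟩)))
      simpa using hd

/-! ### Tamari order interval posets -/

lemma Descendant.refl {t : BinaryTree Unit} {i : ℕ} (hi : i < t.numNodes) : Descendant t i i := by
  obtain ⟨f, -, -, hf, -⟩ := exists_postorder t
  exact (hf i i hi hi).2 fun k hk => by omega

/-- Along the Tamari order the increasing pairs shrink and the decreasing pairs grow. The
intersection is thus decided at `t'` for the former and at `t` for the latter. -/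
lemma forall_tamariLE_descendant_iff {t t' : BinaryTree Unit} (h : TamariLE t t')
    {u v : ℕ} (hu : u < t.numNodes) :
    (∀ s, TamariLE t s → TamariLE s t' → Descendant s u v) ↔
      u = v ∨ (u < v ∧ Descendant t' u v) ∨ (v < u ∧ Descendant t u v) := by
  constructor
  · intro hs
    rcases lt_trichotomy u v with huv | rfl | huv
    · exact Or.inr (Or.inl ⟨huv, hs t' h .refl⟩)
    · exact Or.inl rfl
    · exact Or.inr (Or.inr ⟨huv, hs t .refl h⟩)
  · rintro (rfl | ⟨huv, hd⟩ | ⟨huv, hd⟩) s h1 h2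
    · exact Descendant.refl (h1.numNodes_eq ▸ hu)
    · exact h2.descendant_of_lt huv hd
    · exact h1.descendant_of_gt huv hd

theorem isDeletionImage_WOIP_TOIP : IsDeletionImage WOIP TOIP where
  del_mem {n R} hR := by
    obtain ⟨f, g, hf, hg, hfg, h⟩ := mem_WOIP_iff.1 hR
    have hfe : ∀ i : Fin n, Function.extend Fin.val f 0 i = f i :=
      Fin.val_injective.extend_apply _ _
    have hge : ∀ i : Fin n, Function.extend Fin.val g 0 i = g i :=
      Fin.val_injective.extend_apply _ _
    obtain ⟨t, ht, htf⟩ := exists_isTreeLabeling n (Function.extend Fin.val f 0)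
      fun i hi j hj hij => by
        have h1 := hfe ⟨i, hi⟩
        have h2 := hfe ⟨j, hj⟩
        simpa using hf (h1.symm.trans (hij.trans h2))
    obtain ⟨t', ht', htg⟩ := exists_isTreeLabeling n (Function.extend Fin.val g 0)
      fun i hi j hj hij => by
        have h1 := hge ⟨i, hi⟩
        have h2 := hge ⟨j, hj⟩
        simpa using hg (h1.symm.trans (hij.trans h2))
    -- For `k < j`, a label of `k` smaller than that of `j` under `g` is also smaller under `f`,
    -- since every inversion of `f` is one of `g`.
    have hle : TamariLE t t' := by
      refine tamariLE_of_descendant t' t (ht.trans ht'.symm) fun i j hij hd => ?_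
      have hj : j < n := ht' ▸ hd.lt.2
      rw [htg i j hd.lt.1 hd.lt.2] at hd
      rw [htf i j (by omega) (by omega)]
      intro k hk
      have hk' : k < j := by omega
      have h1 := hfe ⟨k, by omega⟩
      have h2 := hfe ⟨j, hj⟩
      have h3 := hge ⟨k, by omega⟩
      have h4 := hge ⟨j, hj⟩
      have h5 := hd k hk
      rw [h3, h4] at h5
      rw [h1, h2]
      refine lt_of_not_ge fun hle => ?_
      rcases hle.eq_or_lt with he | hlt
      · have := congrArg Fin.val (hf he)
        simp only at this
        omega
      · have := hfg ⟨k, by omega⟩ ⟨j, hj⟩ hk' hlt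
        omega
    refine ⟨t, t', ht, ht', hle, fun u v => ?_⟩
    rw [forall_tamariLE_descendant_iff hle (by omega)]
    rcases lt_trichotomy u v with huv | rfl | huv
    · have hv : (u : ℕ) < v := huv
      have : (u : ℕ) = v ∨ ((u : ℕ) < v ∧ Descendant t' u v) ∨ ((v : ℕ) < u ∧ Descendant t u v) ↔
          Descendant t' u v := by
        simp only [hv, hv.ne, hv.not_gt, true_and, false_and, or_false, false_or]
      rw [this, htg u v (by omega) (by omega)]
      refine (del_apply _ _ _).trans ⟨fun h' k hk => ?_, fun h' b hb => ?_⟩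
      · have hkn : k < n := by omega
        have := (h _ _).1 (h' ⟨k, hkn⟩ hk)
        have h1 := hge ⟨k, hkn⟩
        rw [h1, hge]
        simp only [Fin.ext_iff, Fin.lt_def] at this
        omega
      · rw [h]
        have := h' b hb
        rw [hge, hge] at this
        simp only [Fin.ext_iff, Fin.lt_def, Fin.le_def] at hb ⊢
        omega
    · exact iff_of_true ((toipDeletion R).2 u) (Or.inl rfl)
    · have hv : (v : ℕ) < u := huv
      have : (u : ℕ) = v ∨ ((u : ℕ) < v ∧ Descendant t' u v) ∨ ((v : ℕ) < u ∧ Descendant t u v) ↔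
          Descendant t u v := by
        simp only [hv, hv.ne', hv.not_gt, true_and, false_and, false_or]
      rw [this, htf u v (by omega) (by omega)]
      refine (del_apply _ _ _).trans ⟨fun h' k hk => ?_, fun h' b hb => ?_⟩
      · have hkn : k < n := by omega
        have := (h _ _).1 (h' ⟨k, hkn⟩ hk)
        have h1 := hfe ⟨k, hkn⟩
        rw [h1, hfe]
        simp only [Fin.ext_iff, Fin.lt_def] at this
        omega
      · rw [h]
        have := h' b hb
        rw [hfe, hfe] at this
        simp only [Fin.ext_iff, Fin.lt_def, Fin.le_def] at hb ⊢
        omega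
  exists_del_eq {n T} hT := by
    obtain ⟨t, t', rfl, ht', hle, h⟩ := hT
    simp only [forall_tamariLE_descendant_iff hle (Fin.is_lt _)] at h
    obtain ⟨f, -, hf, htf, hfd⟩ := exists_postorder t
    obtain ⟨g, -, hg, hgd⟩ := exists_reverse_postorder t'
    obtain ⟨g', -, -, htg', -⟩ := exists_postorder t'
    -- `T` is itself a weak order interval poset and is fixed by the deletion. Its interval goes
    -- from the postorder labeling of `t`, with the fewest inversions, to the reverse postorder
    -- labeling of `t'`, with the most.
    refine ⟨T, mem_WOIP_iff.2 ⟨fun u => f u, fun u => g u,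
      fun u v huv => Fin.ext (hf _ u.2 _ v.2 huv),
      fun u v huv => Fin.ext (hg _ (by omega) _ (by omega) huv), fun a b hab hfab => ?_,
      fun u v => ?_⟩, ?_⟩
    · have hab' : (a : ℕ) < b := hab
      have hd := hle.descendant_of_gt hab ((hfd a b hab b.2).1 hfab)
      -- Otherwise `a` and `b` would be descendants of each other in `t'`, which the labeling `g'`
      -- rules out.
      refine lt_of_not_ge fun hle' => ?_
      have hne : g a ≠ g b := fun he => hab'.ne (hg _ (by omega) _ (by omega) he)
      have hd' := (hgd a b hab (by omega)).1 (lt_of_le_of_ne hle' hne)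
      have h1 := (htg' _ _ (by omega) (by omega)).1 hd b (by omega)
      have h2 := (htg' _ _ (by omega) (by omega)).1 hd' a (by omega)
      omega
    · rw [h, Fin.ext_iff]
      refine or_congr_right (or_congr (and_congr_right fun huv => ?_)
        (and_congr_right fun huv => ?_))
      · exact (hgd u v huv (by omega)).symm
      · exact (hfd v u huv u.2).symm
    · ext u v
      refine (del_apply _ _ _).trans ⟨fun h' => ?_, fun h' b hb => ?_⟩
      · rcases lt_trichotomy u v with huv | rfl | huv
        · exact h' u (Or.inl ⟨le_rfl, huv⟩)
        · exact T.2 u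
        · exact h' u (Or.inr ⟨huv, le_rfl⟩)
      · rw [h] at h' ⊢
        simp only [Fin.lt_def, Fin.le_def] at hb
        rcases h' with h' | ⟨huv, h'⟩ | ⟨huv, h'⟩
        · omega
        · refine Or.inr (Or.inl ⟨by omega, ?_⟩)
          rw [htg' _ _ (by omega) (by omega)] at h' ⊢
          exact fun k hk => h' k (by omega)
        · refine Or.inr (Or.inr ⟨by omega, ?_⟩)
          rw [htf _ _ (by omega) (by omega)] at h' ⊢
          exact fun k hk => h' k (by omega)

/-! ### Schröder trees -/

namespace SchroderTree

variable {k : ℕ} (child : Fin (k + 2) → SchroderTree)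

lemma offset_zero : offset child 0 = 0 := by simp [offset]

lemma offset_succ (t : Fin (k + 1)) : offset child t.succ = rootAngle child t + 1 := by
  have : (Finset.univ.filter fun s : Fin (k + 2) => s < t.succ) =
      insert t.castSucc (Finset.univ.filter fun s : Fin (k + 2) => s < t.castSucc) := by
    ext s
    simp only [Finset.mem_filter, Finset.mem_univ, true_and, Finset.mem_insert, Fin.lt_def,
      Fin.ext_iff, Fin.val_succ, Fin.val_castSucc]
    omega
  rw [rootAngle, offset, this, Finset.sum_insert (by simp), offset]
  omega

lemma offset_lt {s t : Fin (k + 2)} (h : s < t) :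
    offset child s + (child s).numAngles < offset child t := by
  induction t using Fin.induction with
  | zero => exact absurd h (Fin.not_lt_zero s)
  | succ t ih =>
    rw [offset_succ, rootAngle]
    rcases (Fin.le_castSucc_iff.2 h).eq_or_lt with rfl | h
    · omega
    · have := ih h; omega

lemma numAngles_node : (node k child).numAngles =
    offset child (Fin.last _) + (child (Fin.last _)).numAngles := by
  have h1 : ∑ t, ((child t).numAngles + 1) = (node k child).numAngles + 1 := by
    rw [Finset.sum_add_distrib, numAngles]
    simp
    omega
  have : (Finset.univ : Finset (Fin (k + 2))) =
      insert (Fin.last _) (Finset.univ.filter fun s : Fin (k + 2) => s < Fin.last _) := by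
    ext s
    simpa using (Fin.le_last s).eq_or_lt
  rw [this, Finset.sum_insert (by simp)] at h1
  rw [offset]
  omega

lemma offset_add_numAngles_le (t : Fin (k + 2)) :
    offset child t + (child t).numAngles ≤ (node k child).numAngles := by
  rw [numAngles_node]
  rcases (Fin.le_last t).eq_or_lt with rfl | h
  · exact le_rfl
  · have := offset_lt child h; omega

variable {child}

lemma exists_rootAngle_or_inChild {i : ℕ} (hi : i < (node k child).numAngles) :
    (∃ t, i = rootAngle child t) ∨ ∃ t, InChild child t i := by
  rw [numAngles_node] at hi
  generalize Fin.last (k + 1) = t at hi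
  induction t using Fin.induction with
  | zero => exact Or.inr ⟨0, by rw [offset_zero]; exact Nat.zero_le _, hi⟩
  | succ t ih =>
    by_cases h : offset child t.succ ≤ i
    · exact Or.inr ⟨_, h, hi⟩
    · rw [offset_succ, rootAngle] at h
      by_cases h' : i = rootAngle child t
      · exact Or.inl ⟨t, h'⟩
      · rw [rootAngle] at h'
        exact ih (by omega)

lemma InChild.lt_of_lt {s t : Fin (k + 2)} {i j : ℕ} (hi : InChild child s i)
    (hj : InChild child t j) (h : s < t) : ∃ r, i < rootAngle child r ∧ rootAngle child r < j := by
  refine ⟨s.castPred (ne_of_lt (h.trans_le (Fin.le_last t))), ?_, ?_⟩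
  · rw [rootAngle, Fin.castSucc_castPred]
    exact hi.2
  · rw [rootAngle, Fin.castSucc_castPred]
    exact (offset_lt child h).trans_le hj.1

lemma InChild.lt_rootAngle {s : Fin (k + 2)} {t : Fin (k + 1)} {i : ℕ} (hi : InChild child s i)
    (h : s ≤ t.castSucc) : i < rootAngle child t := by
  rw [rootAngle]
  rcases h.eq_or_lt with rfl | h
  · exact hi.2
  · have := offset_lt child h
    have := hi.2
    omega

lemma InChild.rootAngle_lt {s : Fin (k + 2)} {t : Fin (k + 1)} {i : ℕ} (hi : InChild child s i)
    (h : t.succ ≤ s) : rootAngle child t < i := by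
  have h1 := offset_succ child t
  have h2 := hi.1
  rcases h.eq_or_lt with rfl | h
  · omega
  · have := offset_lt child h
    omega

lemma InChild.ne_rootAngle {s : Fin (k + 2)} {i : ℕ} (hi : InChild child s i) (t : Fin (k + 1)) :
    i ≠ rootAngle child t := by
  rcases le_or_gt s t.castSucc with h | h
  · exact (hi.lt_rootAngle h).ne
  · exact (hi.rootAngle_lt (Fin.castSucc_lt_iff_succ_le.1 h)).ne'

lemma rootAngle_strictMono : StrictMono (rootAngle child) := by
  intro s t h
  have h1 : s.castSucc < t.castSucc := h
  have := offset_lt child h1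
  rw [rootAngle, rootAngle]
  omega

/-- In the Schröder tree `S`, the angle `i` is below the angle `j` if and only if the label of `j`
is greater than all the labels in the interval between `i` and `j`. -/
def IsLabeling (S : SchroderTree) (f : ℕ → ℕ) : Prop :=
  ∀ i j, i < S.numAngles → j < S.numAngles →
    (S.Below i j ↔ ∀ k, (i ≤ k ∧ k < j ∨ j < k ∧ k ≤ i) → f k < f j)

/-- The root angles share the greatest label `M` and the comparison is strict, so a stretch may meet
no root angle other than `j` itself. A root angle therefore only sees its two adjacent children, and
any other angle only sees its own child of the root. -/
lemma IsLabeling.node {f : ℕ → ℕ} {M : ℕ}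
    (hf : ∀ t, (child t).IsLabeling fun i => f (i + offset child t))
    (hM : ∀ t, f (rootAngle child t) = M) (hlt : ∀ t i, InChild child t i → f i < M) :
    (node k child).IsLabeling f := by
  intro i j hi hj
  rw [Below]
  rcases exists_rootAngle_or_inChild hj with ⟨t, rfl⟩ | ⟨t, ht⟩
  · have h2 : ¬ ∃ s : Fin (k + 2), InChild child s i ∧ InChild child s (rootAngle child t) ∧
        (child s).Below (i - offset child s) (rootAngle child t - offset child s) :=
      fun ⟨s, _, h, _⟩ => h.ne_rootAngle t rfl
    have h1 : (∃ s : Fin (k + 1), rootAngle child t = rootAngle child s ∧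
        (i = rootAngle child t ∨ InChild child s.castSucc i ∨ InChild child s.succ i)) ↔
        (i = rootAngle child t ∨ InChild child t.castSucc i ∨ InChild child t.succ i) := by
      refine ⟨fun ⟨s, hs, h⟩ => ?_, fun h => ⟨t, rfl, h⟩⟩
      obtain rfl := rootAngle_strictMono.injective hs
      exact h
    rw [or_iff_left h2, h1, hM]
    constructor
    · have key : ∀ s, InChild child s i → (s = t.castSucc ∨ s = t.succ) → ∀ l,
          (i ≤ l ∧ l < rootAngle child t ∨ rootAngle child t < l ∧ l ≤ i) → f l < M := by
        rintro s hs (rfl | rfl) l hl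
        · have := hs.lt_rootAngle le_rfl
          have h3 := hs.1
          exact hlt t.castSucc l ⟨by omega, by rw [rootAngle] at hl this; omega⟩
        · have := hs.rootAngle_lt le_rfl
          have h3 := hs.2
          exact hlt t.succ l ⟨by rw [offset_succ]; omega, by omega⟩
      rintro (rfl | h | h)
      · exact fun l hl => by omega
      · exact key _ h (Or.inl rfl)
      · exact key _ h (Or.inr rfl)
    · intro h
      by_cases hit : i = rootAngle child t
      · exact Or.inl hit
      rcases exists_rootAngle_or_inChild hi with ⟨s, rfl⟩ | ⟨s, hs⟩
      · have := h (rootAngle child s) (by omega)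
        rw [hM] at this
        exact absurd this (lt_irrefl _)
      · refine Or.inr ?_
        rcases lt_trichotomy s t.castSucc with hst | rfl | hst
        · exfalso
          have hne : s ≠ Fin.last _ := ne_of_lt (hst.trans_le (Fin.le_last _))
          have h1 := hs.lt_rootAngle (t := s.castPred hne) (by simp)
          have h2 : rootAngle child (s.castPred hne) < rootAngle child t :=
            rootAngle_strictMono (by rwa [Fin.lt_def] at hst ⊢)
          have := h _ (Or.inl ⟨h1.le, h2⟩)
          rw [hM] at this
          exact lt_irrefl _ this
        · exact Or.inl hs
        · rcases (Fin.castSucc_lt_iff_succ_le.1 hst).eq_or_lt with rfl | hst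
          · exact Or.inr hs
          · exfalso
            obtain ⟨r, rfl⟩ := Fin.exists_succ_eq_of_ne_zero (Fin.ne_zero_of_lt hst)
            have h1 := hs.rootAngle_lt (t := r) le_rfl
            have h2 : rootAngle child t < rootAngle child r :=
              rootAngle_strictMono (Fin.succ_lt_succ_iff.1 hst)
            have := h _ (Or.inr ⟨h2, h1.le⟩)
            rw [hM] at this
            exact lt_irrefl _ this
  · have h1 : ¬ ∃ s : Fin (k + 1), j = rootAngle child s ∧
        (i = j ∨ InChild child s.castSucc i ∨ InChild child s.succ i) :=
      fun ⟨s, h, _⟩ => ht.ne_rootAngle s h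
    have hj' := hlt t j ht
    rw [or_iff_right h1]
    rcases exists_rootAngle_or_inChild hi with ⟨s, rfl⟩ | ⟨s, hs⟩
    · refine iff_of_false (fun ⟨r, h, _⟩ => h.ne_rootAngle s rfl) fun h => ?_
      have := h (rootAngle child s) (by have := ht.ne_rootAngle s; omega)
      rw [hM] at this
      omega
    · by_cases hst : s = t
      · subst hst
        have h2 : (∃ r, InChild child r i ∧ InChild child r j ∧
            (child r).Below (i - offset child r) (j - offset child r)) ↔
            (child s).Below (i - offset child s) (j - offset child s) := by
          refine ⟨fun ⟨r, hr, _, h⟩ => ?_, fun h => ⟨s, hs, ht, h⟩⟩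
          suffices r = s by rwa [this] at h
          by_contra hne
          rcases lt_or_gt_of_ne hne with hlt' | hlt'
          · obtain ⟨_, h1, h2⟩ := hr.lt_of_lt hs hlt'; omega
          · obtain ⟨_, h1, h2⟩ := hs.lt_of_lt hr hlt'; omega
        obtain ⟨hs1, hs2⟩ := hs
        obtain ⟨ht1, ht2⟩ := ht
        rw [h2, hf s _ _ (by omega) (by omega)]
        dsimp only
        rw [Nat.sub_add_cancel ht1]
        constructor
        · intro h l hl
          have := h (l - offset child s) (by omega)
          rwa [Nat.sub_add_cancel (by omega)] at this
        · intro h l hl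
          exact h _ (by omega)
      · refine iff_of_false (fun ⟨r, h, h', _⟩ => hst ?_) fun h => ?_
        · trans r
          · by_contra hne
            rcases lt_or_gt_of_ne hne with hlt' | hlt'
            · obtain ⟨_, h1, h2⟩ := hs.lt_of_lt h hlt'; omega
            · obtain ⟨_, h1, h2⟩ := h.lt_of_lt hs hlt'; omega
          · by_contra hne
            rcases lt_or_gt_of_ne hne with hlt' | hlt'
            · obtain ⟨_, h1, h2⟩ := h'.lt_of_lt ht hlt'; omega
            · obtain ⟨_, h1, h2⟩ := ht.lt_of_lt h' hlt'; omega
        · rcases lt_or_gt_of_ne hst with hlt' | hlt'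
          · obtain ⟨r, h1, h2⟩ := hs.lt_of_lt ht hlt'
            have := h _ (Or.inl ⟨h1.le, h2⟩)
            rw [hM] at this; omega
          · obtain ⟨r, h1, h2⟩ := ht.lt_of_lt hs hlt'
            have := h _ (Or.inr ⟨h1, h2.le⟩)
            rw [hM] at this; omega

/-- The children keep their labels and the root angles all get the number of angles minus one. This
exceeds the labels of every child, because the root has at least one angle of its own. -/
lemma exists_isLabeling (S : SchroderTree) :
    ∃ f : ℕ → ℕ, (∀ i < S.numAngles, f i < S.numAngles) ∧ S.IsLabeling f := by
  classical
  induction S with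
  | leaf =>
    exact ⟨id, fun _ h => h, fun i j hi => absurd hi (Nat.not_lt_zero _)⟩
  | node k child ih =>
    choose g hg hgl using ih
    let f : ℕ → ℕ := fun i => if h : ∃ t, InChild child t i then
      g h.choose (i - offset child h.choose) else (node k child).numAngles - 1
    have huniq : ∀ {s t i}, InChild child s i → InChild child t i → s = t := by
      intro s t i hs ht
      by_contra hne
      rcases lt_or_gt_of_ne hne with h | h
      · obtain ⟨_, h1, h2⟩ := hs.lt_of_lt ht h; omega
      · obtain ⟨_, h1, h2⟩ := ht.lt_of_lt hs h; omega
    have hfc : ∀ t i, InChild child t i → f i = g t (i - offset child t) := by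
      intro t i h
      have hex : ∃ t, InChild child t i := ⟨t, h⟩
      simp only [f, dif_pos hex]
      rw [huniq hex.choose_spec h]
    have hfr : ∀ t, f (rootAngle child t) = (node k child).numAngles - 1 := fun t =>
      dif_neg fun ⟨s, h⟩ => h.ne_rootAngle t rfl
    have hlt : ∀ t i, InChild child t i → f i < (node k child).numAngles - 1 := by
      intro t i h
      rw [hfc t i h]
      have h1 := hg t (i - offset child t) (by have := h.1; have := h.2; omega)
      have h2 := Finset.single_le_sum (f := fun t => (child t).numAngles)
        (fun _ _ => Nat.zero_le _) (Finset.mem_univ t)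
      rw [numAngles]
      omega
    refine ⟨f, fun i hi => ?_, IsLabeling.node (fun t i j hi hj => ?_) hfr hlt⟩
    · rcases exists_rootAngle_or_inChild hi with ⟨t, rfl⟩ | ⟨t, ht⟩
      · rw [hfr]; omega
      · have := hlt t i ht; omega
    · rw [hgl t i j hi hj]
      refine forall_congr' fun l => imp_congr_right fun hl => ?_
      dsimp only
      rw [hfc t (l + offset child t) ⟨by omega, by omega⟩,
        hfc t (j + offset child t) ⟨by omega, by omega⟩, Nat.add_sub_cancel, Nat.add_sub_cancel]

/-- The Schröder tree of a labeling, whose root angles are the positions of the greatest label. -/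
lemma exists_of_labeling (n : ℕ) : ∀ f : ℕ → ℕ,
    ∃ S : SchroderTree, S.numAngles = n ∧ S.IsLabeling f := by
  induction n using Nat.strong_induction_on with
  | _ n ih =>
    intro f
    rcases n.eq_zero_or_pos with rfl | hn
    · exact ⟨leaf, rfl, fun i j hi => absurd hi (Nat.not_lt_zero _)⟩
    obtain ⟨m, hm, hmax⟩ := Finset.exists_max_image (Finset.range n) f ⟨0, by simpa⟩
    simp only [Finset.mem_range] at hm hmax
    obtain ⟨k, hk⟩ : ∃ k, ((Finset.range n).filter fun i => f i = f m).card = k + 1 :=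
      Nat.exists_eq_succ_of_ne_zero (Finset.card_ne_zero_of_mem (a := m) (by simpa))
    let p := ((Finset.range n).filter fun i => f i = f m).orderEmbOfFin hk
    have hp : ∀ t, p t < n ∧ f (p t) = f m := fun t => by
      have := Finset.orderEmbOfFin_mem _ hk t
      rwa [Finset.mem_filter, Finset.mem_range] at this
    have hps : ∀ i < n, f i = f m → ∃ t, p t = i := fun i hi hf => by
      have : i ∈ Set.range p := by
        rw [Finset.range_orderEmbOfFin]
        simp [hi, hf]
      exact this
    -- The `k + 1` positions `p` of the maximum separate `k + 2` stretches, possibly empty. The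
    -- child `t` occupies the labels from `lo t` up to, but excluding, `up t`.
    let lo : Fin (k + 2) → ℕ := Fin.cases 0 fun t => p t + 1
    let up : Fin (k + 2) → ℕ := Fin.lastCases n p
    have hlo : ∀ t : Fin (k + 1), lo t.succ = p t + 1 := fun t => rfl
    have hup : ∀ t : Fin (k + 1), up t.castSucc = p t := fun t => by simp [up]
    have hup' : up (Fin.last _) = n := by simp [up]
    have hupn : ∀ t, up t ≤ n := fun t => by
      induction t using Fin.lastCases with
      | last => exact hup'.le
      | cast t => rw [hup]; exact (hp t).1.le
    have hle : ∀ t, lo t ≤ up t := by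
      intro t
      induction t using Fin.cases with
      | zero => exact Nat.zero_le _
      | succ t =>
        rw [hlo]
        rcases Fin.eq_castSucc_or_eq_last t.succ with ⟨s, hs⟩ | hs
        · rw [hs, hup]
          refine p.strictMono ?_
          have := congrArg Fin.val hs
          simp only [Fin.val_succ, Fin.val_castSucc] at this
          rw [Fin.lt_def]
          omega
        · rw [hs, hup']
          exact (hp t).1
    have hlen : ∀ t, up t - lo t < n := by
      intro t
      induction t using Fin.cases with
      | zero =>
        have h0 : up 0 = p 0 := hup 0
        have := (hp 0).1
        omega
      | succ t => have := hlo t; have := hupn t.succ; omega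
    choose child hn hl using fun t => ih _ (hlen t) fun i => f (i + lo t)
    have hoff : ∀ t, offset child t = lo t := by
      intro t
      induction t using Fin.induction with
      | zero => exact offset_zero child
      | succ t iht =>
        rw [offset_succ, rootAngle, iht, hn, hlo, ← hup t]
        have := hle t.castSucc
        omega
    have hroot : ∀ t, rootAngle child t = p t := by
      intro t
      have h1 := offset_succ child t
      rw [hoff, hlo] at h1
      omega
    have hnum : (node k child).numAngles = n := by
      rw [numAngles_node, hoff, hn]
      have := hle (Fin.last _)
      omega
    refine ⟨node k child, hnum, IsLabeling.node (M := f m) (fun t => ?_) (fun t => ?_)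
      fun t i hi => ?_⟩
    · rw [hoff]; exact hl t
    · rw [hroot]; exact (hp t).2
    · have hin : i < n := by
        have := offset_add_numAngles_le child t
        have := hi.2
        omega
      refine (hmax i hin).lt_of_ne fun he => ?_
      obtain ⟨s, rfl⟩ := hps i hin he
      exact hi.ne_rootAngle s (hroot s).symm

end SchroderTree

/-- The deletion of a weak order face poset. -/
lemma del_apply_iff_below {n : ℕ} {R : IRel n} {f : ℕ → ℕ} {S : SchroderTree}
    (hS : S.numAngles = n) (hf : S.IsLabeling f) {v : Fin n}
    (hR : ∀ b : Fin n, b ≠ v → (R.1 b v ↔ f b < f v)) (u : Fin n) :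
    (toipDeletion R).1 u v ↔ S.Below u v := by
  subst hS
  rw [hf u v u.2 v.2]
  refine (del_apply _ _ _).trans ⟨fun h k hk => ?_, fun h b hb => ?_⟩
  · have hkn : k < S.numAngles := by omega
    exact (hR ⟨k, hkn⟩ (by simp [Fin.ext_iff]; omega)).1 (h ⟨k, hkn⟩ hk)
  · exact (hR b (by rintro rfl; simp at hb)).2 (h b hb)

/-- Elements of the same block have equal labels and are incomparable, so strict comparison of
labels describes the poset off the diagonal. Schröder trees absorb the ties. -/
theorem isDeletionImage_WOFP_TOFP : IsDeletionImage WOFP TOFP where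
  del_mem {n R} hR := by
    obtain ⟨f, h⟩ := mem_WOFP_iff.1 hR
    have hfe : ∀ i : Fin n, Function.extend Fin.val f 0 i = f i :=
      Fin.val_injective.extend_apply _ _
    obtain ⟨S, hS, hSf⟩ := SchroderTree.exists_of_labeling n (Function.extend Fin.val f 0)
    refine ⟨S, hS, fun u v => del_apply_iff_below hS hSf (fun b hb => ?_) u⟩
    rw [h, hfe, hfe, or_iff_right hb]
  exists_del_eq {n T} hT := by
    obtain ⟨S, rfl, h⟩ := hT
    obtain ⟨f, -, hf⟩ := S.exists_isLabeling
    refine ⟨⟨fun u v => u = v ∨ f u < f v, fun _ => Or.inl rfl⟩,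
      mem_WOFP_iff.2 ⟨fun u => f u, fun _ _ => Iff.rfl⟩, ReflRel.ext fun u v => ?_⟩
    rw [h]
    exact del_apply_iff_below rfl hf (fun b hb => or_iff_right hb) u

end IntegerPosets

theorem mainTheorem5 (K : Type*) [Field K] :
    IntegerPosets.DefinesHopfSubalgebra K IntegerPosets.WOIP IntegerPosets.TOIP ∧
    IntegerPosets.DefinesHopfSubalgebra K IntegerPosets.WOEP IntegerPosets.TOEP ∧
    IntegerPosets.DefinesHopfSubalgebra K IntegerPosets.WOFP IntegerPosets.TOFP :=
  ⟨IntegerPosets.definesHopfSubalgebra_of_isDeletionImage K IntegerPosets.isDeletionImage_WOIP_TOIP,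
    IntegerPosets.definesHopfSubalgebra_of_isDeletionImage K
      IntegerPosets.isDeletionImage_WOEP_TOEP,
    IntegerPosets.definesHopfSubalgebra_of_isDeletionImage K
      IntegerPosets.isDeletionImage_WOFP_TOFP⟩
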